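/- Let $H$ be a real separable Hilbert space with Borel $\sigma$-algebra, $\mathcal P(H)$ its Borel probability measures, and $\phi_P(w)=\int e^{i\langle w,z\rangle}\,P(dz)$ the characteristic functional of $P$. *The sets.* For $c,c_U,s>0$ let $\mathcal V_G(c)$ be the set of mean-zero Gaussian $\nu\in\mathcal P(H)$ that are symmetric with full support and whose covariance operator $C_\nu$ is strictly positive definite with $\mathrm{tr}(C_\nu)\le c$. For $\rho>0$ let $$\mathcal F_{1,\nu}(\rho)=\Big\{(P_1,P_2)\in\mathcal P(H)^2:\Big[\int_H|\phi_{P_1}-\phi_{P_2}|\,d\nu\Big]^2\ge\rho\Big\},$$ $$\mathcal F_U(c_U,s)=\big\{P^U\in\mathcal P(H):|\phi_{P^U}(w)|\ge c_U(1+\|w\|)^{-s}\ \text{for all } w\in H\big\}.$$ *The data.* Let $Z_1,\dots,Z_{n_1}\sim P_1$, $Z_{n_1+1},\dots,Z_{n_1+n_2}\sim P_2$, and errors $U_1,\dots,U_{n_1+n_2}\sim P^U$, all independent. One observes $\tilde Z_j=Z_j+U_j$. Let $\Pi_1,\dots,\Pi_B$ be i.i.d. uniform random permutations of $\{1,\dots,n_1+n_2\}$,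 independent of the data. *The test.* For a permutation $\pi$ put $$T_\nu(\pi)=\frac{n_1+n_2}{n_1n_2}\sum_{j,k=1}^{n_1+n_2}\phi_\nu(\tilde Z_{\pi(j)}-\tilde Z_{\pi(k)})\,Q_{j,k},$$ $$Q_{j,k}=\frac{\mathbf 1\{j,k\le n_1\}}{n_1}+\frac{\mathbf 1\{j,k>n_1\}}{n_2}-\frac1{n_1+n_2},$$ so that $T_\nu(\mathrm{id})$ is the empirical energy distance of the two observed samples. The level-$\alpha$ permutation test is $$\tilde\psi_\nu(\alpha)=\mathbf 1\Big\{\frac1B\sum_{b=1}^B\mathbf 1\{T_\nu(\mathrm{id})>T_\nu(\Pi_b)\}>1-\alpha\Big\},$$ where the value $1$ means rejection of $P_1=P_2$. *The claim.* For all $c_1,c_2,c,s,c_U>0$ there is a constant $c_0>0$, depending only on these five numbers, such that for all $H$ as above, all integers $n_1,n_2\ge1$ with $c_1\le n_1/n_2\le c_2$, all $\alpha,\beta>0$ with $\alpha+\beta<1$ and $\beta<1/e$, and all integers $B\ge2\alpha^{-2}\log(6/\beta)$, $$\inf\Big\{\rho>0:\ \sup_{\nu\in\mathcal V_G(c)}\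 \sup_{(P_1,P_2)\in\mathcal F_{1,\nu}(\rho),\,P^U\in\mathcal F_U(c_U,s)}\mathbb P\{\tilde\psi_\nu(\alpha)=0\}\le\beta\Big\}\le c_0\,(n_1+n_2)^{-1/2}\{\log(\alpha^{-1})+\log(\beta^{-1})\},$$ where the supremum over an empty set is $0$. -/

import Mathlib

open MeasureTheory ProbabilityTheory
open scoped ENNReal InnerProductSpace

universe u

namespace EnergyTest

noncomputable section

/-- The finite set of permutations of `ι` carries the σ-algebra of all subsets. -/
instance permMeasurableSpace (ι : Type*) : MeasurableSpace (Equiv.Perm ι) := ⊤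

instance permDiscreteMeasurableSpace (ι : Type*) :
    DiscreteMeasurableSpace (Equiv.Perm ι) := ⟨fun _ => trivial⟩

section Reference

variable {H : Type u} [NormedAddCommGroup H] [InnerProductSpace ℝ H] [CompleteSpace H]
  [MeasurableSpace H] [BorelSpace H]

/-- The trace `∑ j, |⟪C e j, e j⟫|` in `[0, ∞]`, along a complete orthonormal system `e` of `H`.
For a positive operator the value does not depend on `e`. -/
def trace (C : H →L[ℝ] H) : ℝ≥0∞ :=
  ∑' j, ENNReal.ofReal
    |⟪C ((exists_hilbertBasis ℝ H).choose_spec.choose j),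
      (exists_hilbertBasis ℝ H).choose_spec.choose j⟫_ℝ|

variable (H) in
/-- Reference probability measures: symmetric with full support. -/
def referenceMeasures : Set (ProbabilityMeasure H) :=
  {ν | (ν : Measure H).IsNegInvariant ∧ (ν : Measure H).support = Set.univ}

variable (H) in
/-- Gaussian reference measures (mean zero, by symmetry) with nondegenerate covariance operator
of trace at most `c`. As the mean is zero, the covariance operator is the operator `C` with
`⟪C x, y⟫ = ∫ z, ⟪x, z⟫ * ⟪y, z⟫ ∂ν`, which is Mathlib's `covarianceOperator`. -/
def gaussianReferenceMeasures (c : ℝ) : Set (ProbabilityMeasure H) :=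
  {ν | ν ∈ referenceMeasures H ∧ IsGaussian (ν : Measure H) ∧
    (∀ x : H, x ≠ 0 → 0 < ⟪covarianceOperator (ν : Measure H) x, x⟫_ℝ) ∧
    trace (covarianceOperator (ν : Measure H)) ≤ ENNReal.ofReal c}

/-- Pairs whose characteristic functionals are separated: `(∫ |φ₁ - φ₂| dν)² ≥ ρ`. -/
def alternatives (ν : ProbabilityMeasure H) (ρ : ℝ) :
    Set (ProbabilityMeasure H × ProbabilityMeasure H) :=
  {P | ρ ≤ (∫ w, ‖charFun (P.1 : Measure H) w - charFun (P.2 : Measure H) w‖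
    ∂(ν : Measure H)) ^ 2}

variable (H) in
/-- Error laws whose characteristic functional decays at most polynomially. -/
def errorLaws (cU s : ℝ) : Set (ProbabilityMeasure H) :=
  {PU | ∀ w : H, cU * (1 + ‖w‖) ^ (-s) ≤ ‖charFun (PU : Measure H) w‖}

end Reference

section Test

variable {H : Type u} [NormedAddCommGroup H] [InnerProductSpace ℝ H] [MeasurableSpace H]

/-- Indices of the pooled sample: `Sum.inl` for the first sample, `Sum.inr` for the second. -/
abbrev Pooled (n₁ n₂ : ℕ) : Type := Fin n₁ ⊕ Fin n₂

/-- The weights `Q j k` of the energy statistic. -/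
def weight (n₁ n₂ : ℕ) (j k : Pooled n₁ n₂) : ℝ :=
  (if j.isLeft ∧ k.isLeft then 1 / (n₁ : ℝ) else 0)
    + (if j.isRight ∧ k.isRight then 1 / (n₂ : ℝ) else 0)
    - 1 / ((n₁ : ℝ) + n₂)

/-- The empirical energy distance of a pooled sample `z`. The characteristic functional of a
symmetric `ν` is real, so the real part changes nothing. -/
def energyStat {n₁ n₂ : ℕ} (ν : ProbabilityMeasure H) (z : Pooled n₁ n₂ → H) : ℝ :=
  ((n₁ : ℝ) + n₂) / (n₁ * n₂) *
    ∑ j, ∑ k, (charFun (ν : Measure H) (z j - z k)).re * weight n₁ n₂ j k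

/-- The permutation test: it rejects (value `1`) when the statistic of the observed sample exceeds
the statistic of the permuted sample for a fraction of more than `1 - α` of the `B`
permutations. -/
def permTest {n₁ n₂ B : ℕ} (α : ℝ) (ν : ProbabilityMeasure H) (z : Pooled n₁ n₂ → H)
    (π : Fin B → Equiv.Perm (Pooled n₁ n₂)) : ℕ :=
  open Classical in
  if 1 - α < 1 / (B : ℝ) *
      ∑ b, (if energyStat ν (fun j => z (π b j)) < energyStat ν z then (1 : ℝ) else 0)
  then 1 else 0

/-- Joint law of the unobserved samples (`P₁` for the first `n₁` indices, `P₂` for the others),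
the measurement errors (iid `PU`) and the `B` iid uniform random permutations, all independent. -/
def experimentLaw (n₁ n₂ B : ℕ) (P₁ P₂ PU : ProbabilityMeasure H) :
    Measure ((Pooled n₁ n₂ → H) × (Pooled n₁ n₂ → H) ×
      (Fin B → Equiv.Perm (Pooled n₁ n₂))) :=
  (Measure.pi (fun j : Pooled n₁ n₂ =>
      Sum.elim (fun _ => (P₁ : Measure H)) (fun _ => (P₂ : Measure H)) j)).prod
    ((Measure.pi (fun _ : Pooled n₁ n₂ => (PU : Measure H))).prod
      (Measure.pi (fun _ : Fin B =>
        uniformOn (Set.univ : Set (Equiv.Perm (Pooled n₁ n₂))))))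

/-- Probability that the test, applied to the contaminated data `z + u`, does not reject. -/
def typeIIError (n₁ n₂ B : ℕ) (α : ℝ) (ν P₁ P₂ PU : ProbabilityMeasure H) : ℝ≥0∞ :=
  experimentLaw n₁ n₂ B P₁ P₂ PU {ω | permTest α ν (ω.1 + ω.2.1) ω.2.2 = 0}

end Test

/-- Uniform separation rate: the infimum, in `[0, ∞]`, of the `ρ > 0` for which the type II error
is at most `β` uniformly over reference measures, alternatives and error laws. -/
def separationRate (H : Type u) [NormedAddCommGroup H] [InnerProductSpace ℝ H] [CompleteSpace H]
    [MeasurableSpace H] [BorelSpace H] (c cU s : ℝ) (n₁ n₂ B : ℕ) (α β : ℝ) : ℝ≥0∞ :=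
  ⨅ (ρ : ℝ) (_ : 0 < ρ ∧
    (⨆ ν ∈ gaussianReferenceMeasures H c, ⨆ P ∈ alternatives ν ρ, ⨆ PU ∈ errorLaws H cU s,
      typeIIError n₁ n₂ B α ν P.1 P.2 PU) ≤ ENNReal.ofReal β),
    ENNReal.ofReal ρ

end

end EnergyTest

namespace EnergyTest

noncomputable section

/-! By the cosine addition formula and Fubini, `energyStat` is the squared L²(ν) distance between
the empirical characteristic functionals of the two samples: the integral over w of the squares of
two differences of means, one of cosines and one of sines. Everything then reduces to differences of
means of numbers in [-1, 1]. Write m for min(n₁, n₂).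

Two such differences are sub-Gaussian with proxy at most 4/m: the randomly permuted one, for fixed
data (`hasSubgaussianMGF_meanDiff_perm`), and the centred one of the independent observations
(`hasSubgaussianMGF_meanDiff_sub`). By Jensen and Tonelli in w, `measure_le_integral_sq_add_sq_le`
gives both integrated squares the tail 2 exp(128 - √m t). No dimension enters, because ν is a
probability measure.

Let D² be the squared L²(ν) distance of the contaminated characteristic functionals. The observed
statistic is at least D²/2 minus the integrated squared error, so D² ≥ 4t puts it above t outside an
event of probability β/2. A permuted statistic reaches t with conditional probability at most α/2,
and Hoeffding over the B permutations makes a frequency of α unlikely (`typeIIError_le`).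

Contamination multiplies the difference of characteristic functionals by that of the error law.
Cauchy-Schwarz undoes this at the price of the ν-moment of (1 + ‖w‖)^(2s), which the trace bounds
uniformly over Gaussian ν (`exists_lintegral_one_add_norm_rpow_le`). Taking t of order (log α⁻¹ +
log β⁻¹)/√m yields the rate. -/

/-- The difference of the means of the two samples. -/
def meanDiff {n₁ n₂ : ℕ} (x : Pooled n₁ n₂ → ℝ) : ℝ :=
  (∑ i, x (Sum.inl i)) / n₁ - (∑ j, x (Sum.inr j)) / n₂

/-! ### Sub-Gaussian bounds for sampling without replacement -/

section Permutation

variable {ι γ : Type*} [Fintype γ] [DecidableEq γ]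

/-- Symmetrization by transpositions of disjoint pairs. -/
lemma sum_perm_exp_pairs_le (s : Finset ι) (f h : ι → γ) (hf : Function.Injective f)
    (hh : Function.Injective h) (hfh : ∀ i j, f i ≠ h j) (y : γ → ℝ) (hy : ∀ x, |y x| ≤ 1)
    (r : ℝ) :
    ∑ π : Equiv.Perm γ, Real.exp (r * ∑ i ∈ s, (y (π (f i)) - y (π (h i)))) ≤
      Fintype.card (Equiv.Perm γ) * Real.exp (s.card * (2 * r ^ 2)) := by
  classical
  induction s using Finset.induction_on with
  | empty => simp
  | insert a s ha ih =>
    set F : Equiv.Perm γ → ℝ := fun π => ∑ i ∈ s, (y (π (f i)) - y (π (h i))) with hF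
    set d : Equiv.Perm γ → ℝ := fun π => y (π (f a)) - y (π (h a)) with hd
    -- Composing with the transposition of the pair `f a`, `h a` preserves the uniform law, flips
    -- the sign of the new term `d`, and leaves the other pairs alone. Averaging the two forms turns
    -- exp into cosh, and cosh x ≤ exp(x²/2) with |d| ≤ 2 gives the factor exp(2r²).
    have hinv : ∀ π, F (π * Equiv.swap (f a) (h a)) = F π := fun π => by
      refine Finset.sum_congr rfl fun i hi => ?_
      have hia : i ≠ a := fun e => ha (e ▸ hi)
      simp only [Equiv.Perm.mul_apply]
      rw [Equiv.swap_apply_of_ne_of_ne (fun e => hia (hf e)) (hfh i a),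
        Equiv.swap_apply_of_ne_of_ne (fun e => hfh a i e.symm) (fun e => hia (hh e))]
    have hneg : ∀ π, d (π * Equiv.swap (f a) (h a)) = -d π := fun π => by
      simp [hd, Equiv.Perm.mul_apply]
    have hd2 : ∀ π, |d π| ≤ 2 := fun π => by
      have h1 := hy (π (f a)); have h2 := hy (π (h a))
      rw [abs_le] at *; simp only [hd]; constructor <;> linarith [h1.1, h1.2, h2.1, h2.2]
    have hrw : ∀ π : Equiv.Perm γ,
        Real.exp (r * ∑ i ∈ insert a s, (y (π (f i)) - y (π (h i)))) =
          Real.exp (r * d π) * Real.exp (r * F π) := fun π => by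
      rw [Finset.sum_insert ha, mul_add, Real.exp_add]
    simp_rw [hrw]
    have hswap : ∑ π, Real.exp (r * d π) * Real.exp (r * F π) =
        ∑ π, Real.exp (-(r * d π)) * Real.exp (r * F π) := by
      rw [← Equiv.sum_comp (Equiv.mulRight (Equiv.swap (f a) (h a)))]
      refine Finset.sum_congr rfl fun π _ => ?_
      simp only [Equiv.coe_mulRight, hinv, hneg, mul_neg]
    have hcosh : ∑ π, Real.exp (r * d π) * Real.exp (r * F π) =
        ∑ π, Real.cosh (r * d π) * Real.exp (r * F π) := by
      have : ∑ π, Real.cosh (r * d π) * Real.exp (r * F π) =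
          (∑ π, Real.exp (r * d π) * Real.exp (r * F π) +
            ∑ π, Real.exp (-(r * d π)) * Real.exp (r * F π)) / 2 := by
        rw [← Finset.sum_add_distrib, Finset.sum_div]
        refine Finset.sum_congr rfl fun π _ => ?_
        rw [Real.cosh_eq]; ring
      rw [this, ← hswap]; ring
    rw [hcosh]
    calc ∑ π, Real.cosh (r * d π) * Real.exp (r * F π)
        ≤ ∑ π, Real.exp (2 * r ^ 2) * Real.exp (r * F π) := by
          refine Finset.sum_le_sum fun π _ => ?_
          gcongr
          refine (Real.cosh_le_exp_half_sq _).trans (Real.exp_le_exp.2 ?_)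
          have h4 : (d π) ^ 2 ≤ 4 := by
            rw [← sq_abs]; nlinarith [hd2 π, abs_nonneg (d π)]
          nlinarith [sq_nonneg r]
      _ = Real.exp (2 * r ^ 2) * ∑ π, Real.exp (r * F π) := by rw [Finset.mul_sum]
      _ ≤ Real.exp (2 * r ^ 2) *
          (Fintype.card (Equiv.Perm γ) * Real.exp (s.card * (2 * r ^ 2))) := by
          gcongr
      _ = _ := by
          rw [Finset.card_insert_of_notMem ha, Nat.cast_add, Nat.cast_one, add_mul, one_mul,
            Real.exp_add]; ring

/-- Sub-Gaussian bound for the difference of the means of two disjoint subsamples drawn without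
replacement, the first one being the smaller. -/
lemma sum_perm_exp_sub_means_le {n₁ n₂ : ℕ} (hn₁ : 0 < n₁) (hle : n₁ ≤ n₂) (f : Fin n₁ → γ)
    (g : Fin n₂ → γ) (hf : Function.Injective f) (hg : Function.Injective g)
    (hfg : ∀ i j, f i ≠ g j) (y : γ → ℝ) (hy : ∀ x, |y x| ≤ 1) (t : ℝ) :
    ∑ π : Equiv.Perm γ,
        Real.exp (t * ((∑ i, y (π (f i))) / n₁ - (∑ j, y (π (g j))) / n₂)) ≤
      Fintype.card (Equiv.Perm γ) * Real.exp (2 * t ^ 2 / n₁) := by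
  have hn₂ : 0 < n₂ := hn₁.trans_le hle
  have : NeZero n₂ := ⟨hn₂.ne'⟩
  have h1 : (n₁ : ℝ) ≠ 0 := by positivity
  have h2 : (n₂ : ℝ) ≠ 0 := by positivity
  -- Cyclic shifts, with addition modulo `n₂`. Each shift `k` pairs the small sample injectively
  -- with part of the large one. For fixed `i` every index is hit once as `k` varies, so averaging
  -- over `k` recovers the full mean and Jensen reduces to the paired bound with r = t/n₁.
  set τ : Fin n₂ → Fin n₁ → Fin n₂ := fun k i => Fin.castLE hle i + k with hτ
  have hτinj : ∀ k, Function.Injective (τ k) := fun k i j hij =>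
    Fin.castLE_injective hle (add_right_cancel hij)
  have havg : ∀ π : Equiv.Perm γ,
      t * ((∑ i, y (π (f i))) / n₁ - (∑ j, y (π (g j))) / n₂) =
        ∑ k : Fin n₂, (1 / (n₂ : ℝ)) *
          (t / n₁ * ∑ i, (y (π (f i)) - y (π (g (τ k i))))) := fun π => by
    have hcol : ∑ k, ∑ i, y (π (g (τ k i))) = n₁ * ∑ j, y (π (g j)) := by
      rw [Finset.sum_comm]
      have : ∀ i, ∑ k, y (π (g (τ k i))) = ∑ j, y (π (g j)) := fun i =>
        Equiv.sum_comp (Equiv.addLeft (Fin.castLE hle i)) fun j => y (π (g j))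
      simp [this]
    simp_rw [← Finset.mul_sum, Finset.sum_sub_distrib, hcol]
    simp only [Finset.sum_const, Finset.card_univ, Fintype.card_fin, nsmul_eq_mul]
    field_simp
  have hjensen : ∀ π : Equiv.Perm γ,
      Real.exp (t * ((∑ i, y (π (f i))) / n₁ - (∑ j, y (π (g j))) / n₂)) ≤
        ∑ k : Fin n₂, (1 / (n₂ : ℝ)) *
          Real.exp (t / n₁ * ∑ i, (y (π (f i)) - y (π (g (τ k i))))) := fun π => by
    rw [havg π]
    have := convexOn_exp.map_sum_le (t := Finset.univ) (w := fun _ : Fin n₂ => 1 / (n₂ : ℝ))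
      (p := fun k => t / n₁ * ∑ i, (y (π (f i)) - y (π (g (τ k i)))))
      (fun _ _ => by positivity) (by simp [h2]) (fun _ _ => Set.mem_univ _)
    simpa only [smul_eq_mul] using this
  calc ∑ π : Equiv.Perm γ,
        Real.exp (t * ((∑ i, y (π (f i))) / n₁ - (∑ j, y (π (g j))) / n₂))
      ≤ ∑ π : Equiv.Perm γ, ∑ k : Fin n₂, (1 / (n₂ : ℝ)) *
          Real.exp (t / n₁ * ∑ i, (y (π (f i)) - y (π (g (τ k i))))) :=
        Finset.sum_le_sum fun π _ => hjensen π
    _ = ∑ k : Fin n₂, (1 / (n₂ : ℝ)) * ∑ π : Equiv.Perm γ,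
          Real.exp (t / n₁ * ∑ i, (y (π (f i)) - y (π (g (τ k i))))) := by
        rw [Finset.sum_comm]; simp_rw [Finset.mul_sum]
    _ ≤ ∑ k : Fin n₂, (1 / (n₂ : ℝ)) *
          (Fintype.card (Equiv.Perm γ) * Real.exp (n₁ * (2 * (t / n₁) ^ 2))) := by
        refine Finset.sum_le_sum fun k _ => ?_
        gcongr
        simpa using sum_perm_exp_pairs_le Finset.univ f (fun i => g (τ k i)) hf
          (hg.comp (hτinj k)) (fun i j => hfg _ _) y hy (t / n₁)
    _ = _ := by
        rw [Finset.sum_const, Finset.card_univ, Fintype.card_fin, nsmul_eq_mul, ← mul_assoc,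
          mul_one_div_cancel h2, one_mul]
        congr 2
        field_simp

end Permutation

/-- The pairing requires the smaller sample to come first; in the other case the roles are exchanged
and `t` becomes `-t`. -/
lemma sum_perm_exp_meanDiff_le {n₁ n₂ : ℕ} (hn₁ : 0 < n₁) (hn₂ : 0 < n₂)
    (y : Pooled n₁ n₂ → ℝ) (hy : ∀ x, |y x| ≤ 1) (t : ℝ) :
    ∑ π : Equiv.Perm (Pooled n₁ n₂), Real.exp (t * meanDiff fun j => y (π j)) ≤
      Fintype.card (Equiv.Perm (Pooled n₁ n₂)) *
        Real.exp (2 * t ^ 2 / (min n₁ n₂ : ℕ)) := by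
  rcases le_total n₁ n₂ with h | h
  · rw [min_eq_left h]
    exact sum_perm_exp_sub_means_le hn₁ h Sum.inl Sum.inr Sum.inl_injective Sum.inr_injective
      (by simp) y hy t
  · rw [min_eq_right h]
    have := sum_perm_exp_sub_means_le hn₂ h (Sum.inr : Fin n₂ → Pooled n₁ n₂) Sum.inl
      Sum.inr_injective Sum.inl_injective (by simp) y hy (-t)
    rw [neg_sq] at this
    refine le_of_eq_of_le (Finset.sum_congr rfl fun π _ => ?_) this
    rw [meanDiff]; congr 1; ring

lemma integral_uniformOn_univ {Ω : Type*} [Fintype Ω] [MeasurableSpace Ω]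
    [MeasurableSingletonClass Ω] (f : Ω → ℝ) :
    ∫ x, f x ∂(uniformOn (Set.univ : Set Ω)) = (∑ x, f x) / Fintype.card Ω := by
  rw [uniformOn, ProbabilityTheory.cond, Measure.restrict_univ, integral_smul_measure,
    integral_count]
  simp [div_eq_inv_mul]

open scoped NNReal in
/-- The difference of means of a randomly permuted bounded sample is sub-Gaussian. -/
lemma hasSubgaussianMGF_meanDiff_perm {n₁ n₂ : ℕ} (hn₁ : 0 < n₁) (hn₂ : 0 < n₂)
    (y : Pooled n₁ n₂ → ℝ) (hy : ∀ x, |y x| ≤ 1) :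
    HasSubgaussianMGF (fun π : Equiv.Perm (Pooled n₁ n₂) => meanDiff fun j => y (π j))
      (4 / (min n₁ n₂ : ℕ) : ℝ≥0) (uniformOn Set.univ) where
  integrable_exp_mul t := Integrable.of_finite
  mgf_le t := by
    rw [mgf, integral_uniformOn_univ, div_le_iff₀ (by positivity), mul_comm]
    refine (sum_perm_exp_meanDiff_le hn₁ hn₂ y hy t).trans_eq ?_
    congr 2
    push_cast
    ring

/-! ### Moments of centred Gaussian measures on a Hilbert space -/

section GaussianMoments

variable {H : Type u} [NormedAddCommGroup H] [InnerProductSpace ℝ H]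

/-- Distinct orthonormal vectors lie at distance √2, so the balls of radius 1/2 around them are
disjoint open sets in a separable space. -/
lemma countable_of_orthonormal [TopologicalSpace.SeparableSpace H] {ι : Type*} {v : ι → H}
    (hv : Orthonormal ℝ v) : Countable ι := by
  refine Pairwise.countable_of_isOpen_disjoint (s := fun i => Metric.ball (v i) (1 / 2)) ?_
    (fun i => Metric.isOpen_ball) (fun i => ⟨v i, by simp⟩)
  intro i j hij
  refine Metric.ball_disjoint_ball ?_
  have h2 : ‖v i - v j‖ ^ 2 = 2 := by
    rw [norm_sub_sq_real, hv.1 i, hv.1 j, hv.2 hij]; norm_num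
  rw [dist_eq_norm]
  nlinarith [norm_nonneg (v i - v j)]

variable [MeasurableSpace H] [BorelSpace H]

lemma integral_inner_eq_zero_of_isNegInvariant {ν : Measure H} [ν.IsNegInvariant] (e : H) :
    ∫ z, ⟪e, z⟫_ℝ ∂ν = 0 := by
  have h := integral_neg_eq_self (fun z : H => ⟪e, z⟫_ℝ) ν
  simp only [inner_neg_right, integral_neg] at h
  linarith

variable [CompleteSpace H] [TopologicalSpace.SeparableSpace H]

lemma map_inner_eq_gaussianReal {ν : Measure H} [IsGaussian ν] [ν.IsNegInvariant] (e : H) :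
    ν.map (fun z => ⟪e, z⟫_ℝ) =
      gaussianReal 0 (⟪covarianceOperator ν e, e⟫_ℝ).toNNReal := by
  have : SecondCountableTopology H := UniformSpace.secondCountable_of_separable H
  have h2 : MemLp id 2 ν := IsGaussian.memLp_two_id
  have h := IsGaussian.map_eq_gaussianReal (μ := ν) (innerSL ℝ e)
  have h0 : ∫ z, (innerSL ℝ e) z ∂ν = 0 := by
    simpa using integral_inner_eq_zero_of_isNegInvariant (ν := ν) e
  have hv : Var[(innerSL ℝ e : H → ℝ); ν] = ⟪covarianceOperator ν e, e⟫_ℝ := by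
    rw [variance_of_integral_eq_zero (by fun_prop) h0, covarianceOperator_inner h2]
    simp [sq]
  rw [h0, hv] at h
  simpa using! h

/-- N(0, v) is the law of √v times a standard normal variable, and squaring turns √v into v. -/
lemma eLpNorm_sq_gaussianReal_zero (v : NNReal) (p : ℝ≥0∞) :
    eLpNorm (fun x : ℝ => x ^ 2) p (gaussianReal 0 v) =
      v * eLpNorm (fun x : ℝ => x ^ 2) p (gaussianReal 0 1) := by
  have h := gaussianReal_map_const_mul (μ := 0) (v := 1) (Real.sqrt v)
  have hv : (NNReal.mk (Real.sqrt v ^ 2) (sq_nonneg _) * 1 : NNReal) = v := by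
    ext; simp
  rw [mul_zero, hv] at h
  rw [← h, eLpNorm_map_measure (by fun_prop) (by fun_prop)]
  have : ((fun x : ℝ => x ^ 2) ∘ fun x => Real.sqrt v * x) = (v : ℝ) • fun x : ℝ => x ^ 2 := by
    ext x; simp [mul_pow]
  rw [this, eLpNorm_const_smul]
  simp

/-- All moments of a centred Gaussian measure are controlled by the trace of its covariance. -/
lemma eLpNorm_norm_sq_le {ν : Measure H} [IsGaussian ν] [ν.IsNegInvariant] {p : ℝ≥0∞}
    (hp : 1 ≤ p) :
    eLpNorm (fun w => ‖w‖ ^ 2) p ν ≤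
      trace (covarianceOperator ν) * eLpNorm (fun x : ℝ => x ^ 2) p (gaussianReal 0 1) := by
  have : SecondCountableTopology H := UniformSpace.secondCountable_of_separable H
  set b := (exists_hilbertBasis ℝ H).choose_spec.choose with hb
  have : Countable (exists_hilbertBasis ℝ H).choose := countable_of_orthonormal b.orthonormal
  set M := eLpNorm (fun x : ℝ => x ^ 2) p (gaussianReal 0 1) with hM
  -- Fatou needs a sequence of partial sums; it exists because the basis is countable. Minkowski
  -- bounds each partial sum by the trace, and Parseval identifies the limit as ‖w‖².
  obtain ⟨u, hu⟩ :=
    Filter.exists_seq_tendsto (Filter.atTop : Filter (Finset (exists_hilbertBasis ℝ H).choose))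
  have hcoord : ∀ j, eLpNorm (fun w => ⟪b j, w⟫_ℝ ^ 2) p ν =
      ENNReal.ofReal |⟪covarianceOperator ν (b j), b j⟫_ℝ| * M := fun j => by
    have h1 : eLpNorm (fun w => ⟪b j, w⟫_ℝ ^ 2) p ν =
        eLpNorm (fun x : ℝ => x ^ 2) p (ν.map fun w => ⟪b j, w⟫_ℝ) := by
      rw [eLpNorm_map_measure (by fun_prop) (by fun_prop)]; rfl
    have h0 : 0 ≤ ⟪covarianceOperator ν (b j), b j⟫_ℝ := by
      rw [covarianceOperator_inner IsGaussian.memLp_two_id]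
      exact integral_nonneg fun z => mul_self_nonneg _
    rw [h1, map_inner_eq_gaussianReal, eLpNorm_sq_gaussianReal_zero, abs_of_nonneg h0]
    rfl
  have hpart : ∀ n, eLpNorm (fun w => ∑ j ∈ u n, ⟪b j, w⟫_ℝ ^ 2) p ν ≤
      trace (covarianceOperator ν) * M := fun n => by
    have : (fun w => ∑ j ∈ u n, ⟪b j, w⟫_ℝ ^ 2) =
        ∑ j ∈ u n, fun w => ⟪b j, w⟫_ℝ ^ 2 := by ext w; simp
    rw [this]
    refine (eLpNorm_sum_le (fun j _ => by fun_prop) hp).trans ?_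
    simp_rw [hcoord]
    rw [← Finset.sum_mul]
    gcongr
    exact ENNReal.sum_le_tsum _
  refine (Lp.eLpNorm_lim_le_liminf_eLpNorm
    (f := fun n w => ∑ j ∈ u n, ⟪b j, w⟫_ℝ ^ 2) (fun n => by fun_prop) _
    (Filter.Eventually.of_forall fun w => ?_)).trans ?_
  · have h := b.hasSum_inner_mul_inner w w
    rw [real_inner_self_eq_norm_sq] at h
    have h' : HasSum (fun j => ⟪b j, w⟫_ℝ ^ 2) (‖w‖ ^ 2) := by
      have he : (fun j => ⟪b j, w⟫_ℝ ^ 2) = fun j => ⟪w, b j⟫_ℝ * ⟪b j, w⟫_ℝ := by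
        ext j; rw [real_inner_comm w, sq]
      rwa [he]
    have h'' : Filter.Tendsto (fun F : Finset _ => ∑ j ∈ F, ⟪b j, w⟫_ℝ ^ 2) Filter.atTop
        (nhds (‖w‖ ^ 2)) := by simpa [HasSum] using h'
    exact h''.comp hu
  · refine Filter.liminf_le_of_le (by isBoundedDefault) fun a ha => ?_
    obtain ⟨n, hn⟩ := ha.exists
    exact hn.trans (hpart n)

/-- The square lies in Lᵖ because the identity lies in L²ᵖ. -/
lemma eLpNorm_sq_gaussianReal_ne_top (p : NNReal) :
    eLpNorm (fun x : ℝ => x ^ 2) p (gaussianReal 0 1) ≠ ⊤ := by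
  have h := (memLp_id_gaussianReal (μ := 0) (v := 1) (2 * p)).norm_rpow_div (q := 2)
  have h2 : ((2 * p : NNReal) : ℝ≥0∞) / 2 = p := by
    rw [ENNReal.coe_mul, ENNReal.coe_ofNat, mul_comm]
    exact ENNReal.mul_div_cancel_right (by norm_num) (by norm_num)
  rw [h2] at h
  have := h.eLpNorm_ne_top
  simpa using this

/-- Uniform bound for the polynomial moments over the Gaussian reference measures. -/
lemma exists_lintegral_one_add_norm_rpow_le (c s : ℝ) :
    ∃ K : ℝ, 0 < K ∧ ∀ (H : Type u) [NormedAddCommGroup H] [InnerProductSpace ℝ H]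
      [CompleteSpace H] [TopologicalSpace.SeparableSpace H] [MeasurableSpace H] [BorelSpace H],
      ∀ ν ∈ gaussianReferenceMeasures H c,
        ∫⁻ w, ENNReal.ofReal ((1 + ‖w‖) ^ (2 * s)) ∂(ν : Measure H) ≤ ENNReal.ofReal K := by
  -- Raising the exponent to at least 1 makes Minkowski's inequality available in Lᵏ; since 1 + ‖w‖
  -- ≥ 1, this only enlarges the integrand.
  set k : ℝ := max s 1 with hk
  have hk1 : 1 ≤ k := le_max_right _ _
  have hk0 : 0 < k := by linarith
  set p : NNReal := ⟨k, hk0.le⟩ with hp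
  set M := eLpNorm (fun x : ℝ => x ^ 2) p (gaussianReal 0 1) with hM
  have hMtop : M ≠ ⊤ := eLpNorm_sq_gaussianReal_ne_top p
  set A : ℝ≥0∞ := (2 * (1 + ENNReal.ofReal c * M)) ^ k with hA
  have hAtop : A ≠ ⊤ := by
    refine ENNReal.rpow_ne_top_of_nonneg hk0.le ?_
    finiteness
  refine ⟨A.toReal + 1, by positivity, ?_⟩
  intro H _ _ _ _ _ _ ν hν
  obtain ⟨⟨hneg, -⟩, hgauss, -, htr⟩ := hν
  have := hneg
  have := hgauss
  have : SecondCountableTopology H := UniformSpace.secondCountable_of_separable H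
  have hp1 : (1 : ℝ≥0∞) ≤ p := by exact_mod_cast hk1
  have hp0 : (p : ℝ≥0∞) ≠ 0 := (zero_lt_one.trans_le hp1).ne'
  have hnorm : eLpNorm (fun w : H => 2 * (1 + ‖w‖ ^ 2)) p (ν : Measure H) ≤
      2 * (1 + ENNReal.ofReal c * M) := by
    have h1 : (fun w : H => 2 * (1 + ‖w‖ ^ 2)) =
        (2 : ℝ) • ((fun _ => (1 : ℝ)) + fun w : H => ‖w‖ ^ 2) := by ext w; simp
    rw [h1, eLpNorm_const_smul]
    have h2 : ‖(2 : ℝ)‖ₑ = 2 := by simp [← ofReal_norm]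
    rw [h2]
    gcongr
    refine (eLpNorm_add_le (by fun_prop) (by fun_prop) hp1).trans ?_
    gcongr
    · rw [eLpNorm_const _ hp0 (NeZero.ne _)]; simp
    · refine (eLpNorm_norm_sq_le hp1).trans ?_
      gcongr
  have hle : ∫⁻ w, ENNReal.ofReal ((1 + ‖w‖) ^ (2 * s)) ∂(ν : Measure H) ≤
      ∫⁻ w, ‖2 * (1 + ‖w‖ ^ 2)‖ₑ ^ k ∂(ν : Measure H) := by
    refine lintegral_mono fun w => ?_
    rw [Real.enorm_of_nonneg (by positivity), ENNReal.ofReal_rpow_of_nonneg (by positivity) hk0.le]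
    refine ENNReal.ofReal_le_ofReal ?_
    calc (1 + ‖w‖) ^ (2 * s) ≤ (1 + ‖w‖) ^ (2 * k) :=
          Real.rpow_le_rpow_of_exponent_le (by linarith [norm_nonneg w])
            (by linarith [le_max_left s 1])
      _ = ((1 + ‖w‖) ^ 2) ^ k := by
          rw [Real.rpow_mul (by positivity)]; norm_num
      _ ≤ (2 * (1 + ‖w‖ ^ 2)) ^ k := by
          refine Real.rpow_le_rpow (by positivity) ?_ hk0.le
          nlinarith [sq_nonneg (1 - ‖w‖)]
  refine hle.trans ?_
  have hint : ∫⁻ w, ‖2 * (1 + ‖w‖ ^ 2)‖ₑ ^ k ∂(ν : Measure H) =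
      eLpNorm (fun w : H => 2 * (1 + ‖w‖ ^ 2)) p (ν : Measure H) ^ k := by
    rw [eLpNorm_eq_lintegral_rpow_enorm_toReal hp0 ENNReal.coe_ne_top]
    have hpk : (p : ℝ≥0∞).toReal = k := rfl
    rw [hpk, ← ENNReal.rpow_mul, one_div, inv_mul_cancel₀ hk0.ne', ENNReal.rpow_one]
  rw [hint]
  calc _ ≤ A := ENNReal.rpow_le_rpow hnorm hk0.le
    _ = ENNReal.ofReal A.toReal := (ENNReal.ofReal_toReal hAtop).symm
    _ ≤ _ := ENNReal.ofReal_le_ofReal (by linarith)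

end GaussianMoments

/-! ### Exponential tails for integrated squares and for frequencies -/

section Concentration

variable {Ω W : Type*} [MeasurableSpace Ω] [MeasurableSpace W]

/-- Linearising by x² ≤ 4|x| leaves exponentials of linear terms, which a sub-Gaussian bound
controls at every scale. The product is split by ab ≤ (a² + b²)/2, and exp|z| ≤ exp z + exp(-z)
removes the absolute values. -/
lemma exp_mul_sq_add_sq_le {l x y : ℝ} (hl : 0 ≤ l) (hx : |x| ≤ 4) (hy : |y| ≤ 4) :
    Real.exp (l * (x ^ 2 + y ^ 2)) ≤
      (Real.exp (8 * l * x) + Real.exp (-(8 * l) * x) +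
        (Real.exp (8 * l * y) + Real.exp (-(8 * l) * y))) / 2 := by
  have habs : ∀ z : ℝ, Real.exp (8 * l * |z|) ≤ Real.exp (8 * l * z) + Real.exp (-(8 * l) * z) := by
    intro z
    rcases abs_cases z with ⟨h, -⟩ | ⟨h, -⟩ <;> rw [h]
    · linarith [Real.exp_pos (-(8 * l) * z)]
    · rw [mul_neg, ← neg_mul]; linarith [Real.exp_pos (8 * l * z)]
  have h1 : l * (x ^ 2 + y ^ 2) ≤ 4 * l * |x| + 4 * l * |y| := by
    have hx2 : x ^ 2 ≤ 4 * |x| := by rw [← sq_abs]; nlinarith [abs_nonneg x]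
    have hy2 : y ^ 2 ≤ 4 * |y| := by rw [← sq_abs]; nlinarith [abs_nonneg y]
    nlinarith
  have h2 : Real.exp (4 * l * |x| + 4 * l * |y|) ≤
      (Real.exp (8 * l * |x|) + Real.exp (8 * l * |y|)) / 2 := by
    have e1 : Real.exp (8 * l * |x|) = Real.exp (4 * l * |x|) ^ 2 := by
      rw [← Real.exp_nat_mul]; congr 1; push_cast; ring
    have e2 : Real.exp (8 * l * |y|) = Real.exp (4 * l * |y|) ^ 2 := by
      rw [← Real.exp_nat_mul]; congr 1; push_cast; ring
    rw [Real.exp_add, e1, e2]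
    nlinarith [sq_nonneg (Real.exp (4 * l * |x|) - Real.exp (4 * l * |y|))]
  refine (Real.exp_le_exp.2 h1).trans (h2.trans ?_)
  linarith [habs x, habs y]

/-- Exponential tail bound for the squared `L²` norm of a random field whose coordinates are
bounded and sub-Gaussian. -/
lemma measure_le_integral_sq_add_sq_le {P : Measure Ω} [IsProbabilityMeasure P] {ν : Measure W}
    [IsProbabilityMeasure ν] {X Y : Ω → W → ℝ} (hX : Measurable (Function.uncurry X))
    (hY : Measurable (Function.uncurry Y)) (hXb : ∀ ω w, |X ω w| ≤ 4)
    (hYb : ∀ ω w, |Y ω w| ≤ 4) {m : ℝ} (hm : 0 < m) {σ : NNReal} (hσ : (σ : ℝ) ≤ 4 / m)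
    (hXs : ∀ w, HasSubgaussianMGF (fun ω => X ω w) σ P)
    (hYs : ∀ w, HasSubgaussianMGF (fun ω => Y ω w) σ P) (t : ℝ) :
    P {ω | t ≤ ∫ w, (X ω w ^ 2 + Y ω w ^ 2) ∂ν} ≤
      ENNReal.ofReal (2 * Real.exp (128 - Real.sqrt m * t)) := by
  set l := Real.sqrt m with hl
  have hl0 : 0 < l := Real.sqrt_pos.2 hm
  set Φ : Ω → W → ℝ := fun ω w =>
    (Real.exp (8 * l * X ω w) + Real.exp (-(8 * l) * X ω w) +
      (Real.exp (8 * l * Y ω w) + Real.exp (-(8 * l) * Y ω w))) / 2 with hΦ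
  have hΦm : Measurable (Function.uncurry Φ) := by
    have : Function.uncurry Φ = fun p =>
      (Real.exp (8 * l * Function.uncurry X p) + Real.exp (-(8 * l) * Function.uncurry X p) +
      (Real.exp (8 * l * Function.uncurry Y p) + Real.exp (-(8 * l) * Function.uncurry Y p))) / 2 :=
      rfl
    rw [this]; fun_prop
  have hXw : ∀ ω, Measurable (X ω) := fun ω => hX.of_uncurry_left
  have hYw : ∀ ω, Measurable (Y ω) := fun ω => hY.of_uncurry_left
  set F : Ω → ℝ≥0∞ := fun ω => ∫⁻ w, ENNReal.ofReal (Φ ω w) ∂ν with hF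
  have hFm : Measurable F := by
    exact Measurable.lintegral_prod_right' (f := fun p => ENNReal.ofReal (Function.uncurry Φ p))
      hΦm.ennreal_ofReal
  have hsq : ∀ ω w, X ω w ^ 2 + Y ω w ^ 2 ≤ 32 := fun ω w => by
    have h1 := hXb ω w; have h2 := hYb ω w
    rw [← sq_abs (X ω w), ← sq_abs (Y ω w)]
    nlinarith [abs_nonneg (X ω w), abs_nonneg (Y ω w)]
  have hjensen : ∀ ω, ENNReal.ofReal (Real.exp (l * ∫ w, (X ω w ^ 2 + Y ω w ^ 2) ∂ν)) ≤ F ω := by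
    intro ω
    have hXω := hXw ω
    have hYω := hYw ω
    have hg : Integrable (fun w => l * (X ω w ^ 2 + Y ω w ^ 2)) ν := by
      refine Integrable.of_bound (by fun_prop) (l * 32) (ae_of_all _ fun w => ?_)
      rw [Real.norm_of_nonneg (by positivity)]
      gcongr
      exact hsq ω w
    have hge : Integrable (fun w => Real.exp (l * (X ω w ^ 2 + Y ω w ^ 2))) ν := by
      refine Integrable.of_bound (by fun_prop) (Real.exp (l * 32)) (ae_of_all _ fun w => ?_)
      rw [Real.norm_of_nonneg (by positivity)]
      gcongr
      exact hsq ω w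
    have hj := convexOn_exp.map_integral_le (μ := ν) (f := fun w => l * (X ω w ^ 2 + Y ω w ^ 2))
      Real.continuous_exp.continuousOn isClosed_univ (ae_of_all _ fun _ => Set.mem_univ _) hg hge
    rw [integral_const_mul] at hj
    refine (ENNReal.ofReal_le_ofReal hj).trans ?_
    rw [ofReal_integral_eq_lintegral_ofReal hge (ae_of_all _ fun w => (Real.exp_pos _).le)]
    exact lintegral_mono fun w =>
      ENNReal.ofReal_le_ofReal (exp_mul_sq_add_sq_le hl0.le (hXb ω w) (hYb ω w))
  -- With l = √m the exponents are r = ±8l, so σr²/2 ≤ (4/m)(64m)/2 = 128: the exponential moment is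
  -- bounded independently of m.
  have hmgf : ∀ Z : Ω → ℝ, HasSubgaussianMGF Z σ P → ∀ r : ℝ, r ^ 2 = 64 * m →
      ∫ ω, Real.exp (r * Z ω) ∂P ≤ Real.exp 128 := fun Z hZ r hr => by
    refine (hZ.mgf_le r).trans (Real.exp_le_exp.2 ?_)
    rw [hr]
    calc (σ : ℝ) * (64 * m) / 2 ≤ (4 / m) * (64 * m) / 2 := by gcongr
      _ = 128 := by field_simp; norm_num
  have hl2 : (8 * l) ^ 2 = 64 * m := by rw [mul_pow, hl, Real.sq_sqrt hm.le]; norm_num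
  have hl2' : (-(8 * l)) ^ 2 = 64 * m := by rw [neg_sq, hl2]
  have hEF : ∫⁻ ω, F ω ∂P ≤ ENNReal.ofReal (2 * Real.exp 128) := by
    rw [hF, lintegral_lintegral_swap (f := fun ω w => ENNReal.ofReal (Φ ω w))
      hΦm.ennreal_ofReal.aemeasurable]
    refine (lintegral_mono (g := fun _ => ENNReal.ofReal (2 * Real.exp 128)) fun w => ?_).trans
      (by simp)
    have i1 := (hXs w).integrable_exp_mul (8 * l)
    have i2 := (hXs w).integrable_exp_mul (-(8 * l))
    have i3 := (hYs w).integrable_exp_mul (8 * l)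
    have i4 := (hYs w).integrable_exp_mul (-(8 * l))
    change ∫⁻ ω, ENNReal.ofReal (Φ ω w) ∂P ≤ _
    have i12 : Integrable (fun ω => Real.exp (8 * l * X ω w) + Real.exp (-(8 * l) * X ω w)) P :=
      i1.add i2
    have i34 : Integrable (fun ω => Real.exp (8 * l * Y ω w) + Real.exp (-(8 * l) * Y ω w)) P :=
      i3.add i4
    have iΦ : Integrable (fun ω => Φ ω w) P := (i12.add i34).div_const 2
    rw [← ofReal_integral_eq_lintegral_ofReal iΦ
      (ae_of_all _ fun ω => by simp only [hΦ, Pi.zero_apply]; positivity)]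
    refine ENNReal.ofReal_le_ofReal ?_
    simp only [hΦ]
    rw [integral_div, integral_add i12 i34, integral_add i1 i2,
      integral_add i3 i4]
    linarith [hmgf _ (hXs w) _ hl2, hmgf _ (hXs w) _ hl2', hmgf _ (hYs w) _ hl2,
      hmgf _ (hYs w) _ hl2']
  calc P {ω | t ≤ ∫ w, (X ω w ^ 2 + Y ω w ^ 2) ∂ν}
      ≤ P {ω | ENNReal.ofReal (Real.exp (l * t)) ≤ F ω} := by
        refine measure_mono fun ω hω => ?_
        refine le_trans (ENNReal.ofReal_le_ofReal (Real.exp_le_exp.2 ?_)) (hjensen ω)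
        exact mul_le_mul_of_nonneg_left hω hl0.le
    _ ≤ (∫⁻ ω, F ω ∂P) / ENNReal.ofReal (Real.exp (l * t)) :=
        meas_ge_le_lintegral_div hFm.aemeasurable
          (ENNReal.ofReal_pos.2 (Real.exp_pos _)).ne' ENNReal.ofReal_ne_top
    _ ≤ ENNReal.ofReal (2 * Real.exp 128) / ENNReal.ofReal (Real.exp (l * t)) := by gcongr
    _ = _ := by
        rw [← ENNReal.ofReal_div_of_pos (Real.exp_pos _), mul_div_assoc, ← Real.exp_sub]

lemma hasSubgaussianMGF_eval {ι : Type*} [Fintype ι] (μ : ι → Measure Ω)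
    [∀ i, IsProbabilityMeasure (μ i)] (i : ι) {f : Ω → ℝ} {σ : NNReal}
    (h : HasSubgaussianMGF f σ (μ i)) :
    HasSubgaussianMGF (fun x : ι → Ω => f (x i)) σ (Measure.pi μ) :=
  HasSubgaussianMGF.of_map (Y := fun x : ι → Ω => x i)
    (measurable_pi_apply i).aemeasurable (by rwa [(measurePreserving_eval μ i).map_eq])

/-- Hoeffding's inequality for the frequency of an event of probability at most `α / 2`. -/
lemma pi_frequency_ge_le {P : Measure Ω} [IsProbabilityMeasure P] {E : Set Ω}
    (hE : MeasurableSet E) {α : ℝ} (hα : 0 < α) (hPE : P E ≤ ENNReal.ofReal (α / 2)) {B : ℕ}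
    (hB : 0 < B) :
    Measure.pi (fun _ : Fin B => P)
        {π | α ≤ 1 / (B : ℝ) * ∑ b, E.indicator (fun _ => (1 : ℝ)) (π b)} ≤
      ENNReal.ofReal (Real.exp (-(B * α ^ 2 / 2))) := by
  set f : Ω → ℝ := E.indicator fun _ => (1 : ℝ) with hf
  have hfm : Measurable f := measurable_const.indicator hE
  have hfi : ∫ ω, f ω ∂P ≤ α / 2 := by
    rw [hf, integral_indicator_const _ hE, smul_eq_mul, mul_one]
    exact ENNReal.toReal_le_of_le_ofReal (by positivity) hPE
  have hBr : (0 : ℝ) < B := by exact_mod_cast hB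
  have hsub : HasSubgaussianMGF (fun ω => f ω - ∫ ω, f ω ∂P) ((‖(1 : ℝ) - 0‖₊ / 2) ^ 2) P :=
    hasSubgaussianMGF_of_mem_Icc hfm.aemeasurable (ae_of_all _ fun ω => by
      by_cases h : ω ∈ E <;> simp [hf, h])
  have hsubpi : ∀ b : Fin B, HasSubgaussianMGF
      (fun π : Fin B → Ω => f (π b) - ∫ ω, f ω ∂P) ((‖(1 : ℝ) - 0‖₊ / 2) ^ 2)
      (Measure.pi fun _ : Fin B => P) := fun b => hasSubgaussianMGF_eval (fun _ => P) b hsub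
  have hind : iIndepFun (fun (b : Fin B) (π : Fin B → Ω) => f (π b) - ∫ ω, f ω ∂P)
      (Measure.pi fun _ : Fin B => P) :=
    iIndepFun_pi (X := fun _ ω => f ω - ∫ ω, f ω ∂P) fun _ => by fun_prop
  -- A frequency of at least α exceeds the mean, at most α/2, by α/2. An indicator has proxy 1/4, so
  -- the exponent is -(Bα/2)²/(2B/4) = -Bα²/2.
  have h := HasSubgaussianMGF.measure_sum_ge_le_of_iIndepFun hind (s := Finset.univ)
    (fun b _ => hsubpi b) (ε := B * (α / 2)) (by positivity)
  refine (measure_mono (t := {π | B * (α / 2) ≤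
    ∑ b : Fin B, (f (π b) - ∫ ω, f ω ∂P)}) fun π hπ => ?_).trans ?_
  · simp only [Set.mem_ofPred_eq, Finset.sum_sub_distrib, Finset.sum_const, Finset.card_univ,
      Fintype.card_fin, nsmul_eq_mul] at hπ ⊢
    rw [one_div, inv_mul_eq_div, le_div_iff₀ hBr] at hπ
    nlinarith
  · rw [← ofReal_measureReal]
    refine ENNReal.ofReal_le_ofReal (h.trans_eq ?_)
    congr 1
    simp
    field_simp

end Concentration

/-! ### Differences of means and contaminated samples -/

section MeanDiff

variable {n₁ n₂ : ℕ}

lemma meanDiff_sub (x y : Pooled n₁ n₂ → ℝ) :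
    meanDiff (fun j => x j - y j) = meanDiff x - meanDiff y := by
  simp only [meanDiff, Finset.sum_sub_distrib]; ring

lemma meanDiff_eq_sum (x : Pooled n₁ n₂ → ℝ) :
    meanDiff x = ∑ j, Sum.elim (fun _ => (1 : ℝ) / n₁) (fun _ => -(1 / (n₂ : ℝ))) j * x j := by
  simp only [meanDiff, Fintype.sum_sum_type, Sum.elim_inl, Sum.elim_inr, ← Finset.mul_sum]
  ring

lemma abs_meanDiff_le (hn₁ : 0 < n₁) (hn₂ : 0 < n₂) {x : Pooled n₁ n₂ → ℝ}
    (hx : ∀ j, |x j| ≤ 1) : |meanDiff x| ≤ 2 := by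
  have h1 : |(∑ i, x (Sum.inl i)) / n₁| ≤ 1 := by
    rw [abs_div, Nat.abs_cast, div_le_one (by positivity)]
    refine (Finset.abs_sum_le_sum_abs _ _).trans
      ((Finset.sum_le_sum fun i _ => hx (Sum.inl i)).trans (by simp))
  have h2 : |(∑ i, x (Sum.inr i)) / n₂| ≤ 1 := by
    rw [abs_div, Nat.abs_cast, div_le_one (by positivity)]
    refine (Finset.abs_sum_le_sum_abs _ _).trans
      ((Finset.sum_le_sum fun i _ => hx (Sum.inr i)).trans (by simp))
  exact (abs_sub _ _).trans (by linarith)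

/-- The weights are designed so that a rank-one kernel gives a perfect square: 1/n₁ - 1/(n₁ + n₂) =
n₂/(n₁(n₁ + n₂)), and the prefactor turns this into 1/n₁²; the second sample and the cross terms
behave likewise. -/
lemma sum_sum_mul_weight (hn₁ : 0 < n₁) (hn₂ : 0 < n₂) (x : Pooled n₁ n₂ → ℝ) :
    ((n₁ : ℝ) + n₂) / (n₁ * n₂) * ∑ j, ∑ k, x j * x k * weight n₁ n₂ j k = meanDiff x ^ 2 := by
  have h1 : (n₁ : ℝ) ≠ 0 := by positivity
  have h2 : (n₂ : ℝ) ≠ 0 := by positivity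
  have h3 : (n₁ : ℝ) + n₂ ≠ 0 := by positivity
  set a := ∑ i, x (Sum.inl i) with ha
  set b := ∑ i, x (Sum.inr i) with hb
  have : ∑ j, ∑ k, x j * x k * weight n₁ n₂ j k =
      a * a * (1 / n₁ - 1 / ((n₁ : ℝ) + n₂)) + b * b * (1 / n₂ - 1 / ((n₁ : ℝ) + n₂)) -
        2 * (a * b * (1 / ((n₁ : ℝ) + n₂))) := by
    simp only [Fintype.sum_sum_type, weight, Sum.isLeft_inl, Sum.isLeft_inr, Sum.isRight_inl,
      Sum.isRight_inr, and_true, and_false, if_true, if_false, Bool.false_eq_true,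
      ← Finset.sum_mul, ← Finset.mul_sum, Finset.sum_add_distrib, ← ha, ← hb]
    ring
  rw [this, meanDiff, ← ha, ← hb]
  field_simp
  ring

/-- Hoeffding's lemma for the centred difference of means of two independent samples. -/
lemma hasSubgaussianMGF_meanDiff_sub {E : Type*} [MeasurableSpace E] (hn₁ : 0 < n₁)
    (hn₂ : 0 < n₂) (μ : Pooled n₁ n₂ → Measure E) [∀ j, IsProbabilityMeasure (μ j)] {g : E → ℝ}
    (hg : Measurable g) (hgb : ∀ x, |g x| ≤ 1) :
    HasSubgaussianMGF
      (fun z : Pooled n₁ n₂ → E => meanDiff fun j => g (z j) - ∫ x, g x ∂(μ j))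
      (1 / n₁ + 1 / n₂) (Measure.pi μ) := by
  set a : Pooled n₁ n₂ → ℝ := Sum.elim (fun _ => (1 : ℝ) / n₁) (fun _ => -(1 / (n₂ : ℝ)))
  have h1 : ∀ j, HasSubgaussianMGF (fun z : Pooled n₁ n₂ → E => a j * (g (z j) - ∫ x, g x ∂(μ j)))
      (NNReal.mk (a j ^ 2) (sq_nonneg _) * (‖(1 : ℝ) - (-1)‖₊ / 2) ^ 2) (Measure.pi μ) := fun j =>
    hasSubgaussianMGF_eval μ j (f := fun x => a j * (g x - ∫ x, g x ∂(μ j)))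
      ((hasSubgaussianMGF_of_mem_Icc hg.aemeasurable
        (ae_of_all _ fun x => abs_le.1 (hgb x))).const_mul (a j))
  have hind : iIndepFun (fun j (z : Pooled n₁ n₂ → E) => a j * (g (z j) - ∫ x, g x ∂(μ j)))
      (Measure.pi μ) :=
    iIndepFun_pi (X := fun j x => a j * (g x - ∫ x, g x ∂(μ j))) fun _ => by fun_prop
  have h := HasSubgaussianMGF.sum_of_iIndepFun hind (s := Finset.univ) fun j _ => h1 j
  have hpar : ∑ j, (NNReal.mk (a j ^ 2) (sq_nonneg _) * (‖(1 : ℝ) - (-1)‖₊ / 2) ^ 2 : NNReal) =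
      1 / n₁ + 1 / n₂ := by
    ext
    have h2 : ‖(1 : ℝ) - (-1)‖₊ = 2 := by ext; norm_num
    have hn₁' : (n₁ : ℝ) ≠ 0 := by positivity
    have hn₂' : (n₂ : ℝ) ≠ 0 := by positivity
    have h3 : ∀ j, ((NNReal.mk (a j ^ 2) (sq_nonneg _) * (‖(1 : ℝ) - (-1)‖₊ / 2) ^ 2 : NNReal) : ℝ) =
        a j ^ 2 := fun j => by
      rw [h2, div_self two_ne_zero, one_pow, mul_one]; rfl
    rw [NNReal.coe_sum]
    simp_rw [h3]
    simp [Fintype.sum_sum_type, a]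
    field_simp
  rw [hpar] at h
  simp_rw [meanDiff_eq_sum]
  exact h

/-- Adding independent errors to independent observations gives independent observations. -/
lemma map_add_pi_prod_pi {ι E : Type*} [Fintype ι] [MeasurableSpace E] [AddMonoid E]
    [MeasurableAdd₂ E] (μ κ : ι → Measure E) [∀ i, IsProbabilityMeasure (μ i)]
    [∀ i, IsProbabilityMeasure (κ i)] :
    ((Measure.pi μ).prod (Measure.pi κ)).map (fun p => p.1 + p.2) =
      Measure.pi fun i => (μ i).conv (κ i) := by
  have h := (measurePreserving_arrowProdEquivProdArrow E E ι μ κ).map_eq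
  rw [← h, Measure.map_map (by fun_prop) (MeasurableEquiv.measurable _)]
  have : (fun i => (μ i).conv (κ i)) = fun i => ((μ i).prod (κ i)).map fun p => p.1 + p.2 := rfl
  rw [this, ← Measure.pi_map_pi fun i => by fun_prop]
  rfl

end MeanDiff

/-! ### The energy statistic as an L² distance of characteristic functionals -/

section CharFun

variable {H : Type u} [NormedAddCommGroup H] [InnerProductSpace ℝ H] [MeasurableSpace H]
  [BorelSpace H]

lemma charFun_re_eq (μ : Measure H) [IsProbabilityMeasure μ] (t : H) :
    (charFun μ t).re = ∫ x, Real.cos ⟪x, t⟫_ℝ ∂μ := by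
  have hint : Integrable (fun x => Complex.exp (⟪x, t⟫_ℝ * Complex.I)) μ := by
    refine Integrable.of_bound (by fun_prop) 1 (ae_of_all _ fun x => ?_)
    rw [Complex.norm_exp_ofReal_mul_I]
  rw [charFun_apply]
  refine (integral_re hint).symm.trans ?_
  simp [Complex.exp_ofReal_mul_I_re]

lemma charFun_im_eq (μ : Measure H) [IsProbabilityMeasure μ] (t : H) :
    (charFun μ t).im = ∫ x, Real.sin ⟪x, t⟫_ℝ ∂μ := by
  have hint : Integrable (fun x => Complex.exp (⟪x, t⟫_ℝ * Complex.I)) μ := by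
    refine Integrable.of_bound (by fun_prop) 1 (ae_of_all _ fun x => ?_)
    rw [Complex.norm_exp_ofReal_mul_I]
  rw [charFun_apply]
  refine (integral_im hint).symm.trans ?_
  simp [Complex.exp_ofReal_mul_I_im]

/-- The energy statistic is the squared `L²(ν)` distance of the empirical characteristic
functionals of the two samples. -/
lemma energyStat_eq_integral {n₁ n₂ : ℕ} (hn₁ : 0 < n₁) (hn₂ : 0 < n₂)
    (ν : ProbabilityMeasure H) (z : Pooled n₁ n₂ → H) :
    energyStat ν z = ∫ w, (meanDiff (fun j => Real.cos ⟪z j, w⟫_ℝ) ^ 2 +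
      meanDiff (fun j => Real.sin ⟪z j, w⟫_ℝ) ^ 2) ∂(ν : Measure H) := by
  have hcos : ∀ y : H, Integrable (fun w : H => Real.cos ⟪w, y⟫_ℝ) (ν : Measure H) := fun y =>
    Integrable.of_bound (by fun_prop) 1 (ae_of_all _ fun x => Real.abs_cos_le_one _)
  simp only [energyStat, charFun_re_eq]
  -- The addition formula writes cos⟨w, z j - z k⟩ as a sum of two rank-one kernels, one in cosines
  -- and one in sines.
  have : ∀ w, meanDiff (fun j => Real.cos ⟪z j, w⟫_ℝ) ^ 2 +
      meanDiff (fun j => Real.sin ⟪z j, w⟫_ℝ) ^ 2 = ((n₁ : ℝ) + n₂) / (n₁ * n₂) *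
        ∑ j, ∑ k, Real.cos ⟪w, z j - z k⟫_ℝ * weight n₁ n₂ j k := fun w => by
    rw [← sum_sum_mul_weight hn₁ hn₂, ← sum_sum_mul_weight hn₁ hn₂, ← mul_add,
      ← Finset.sum_add_distrib]
    congr 1
    refine Finset.sum_congr rfl fun j _ => ?_
    rw [← Finset.sum_add_distrib]
    refine Finset.sum_congr rfl fun k _ => ?_
    rw [inner_sub_right, Real.cos_sub, real_inner_comm w, real_inner_comm w]
    ring
  simp_rw [this]
  rw [integral_const_mul, integral_finsetSum _ fun j _ =>
    integrable_finsetSum _ fun k _ => (hcos _).mul_const _]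
  congr 1
  refine Finset.sum_congr rfl fun j _ => ?_
  rw [integral_finsetSum _ fun k _ => (hcos _).mul_const _]
  simp_rw [integral_mul_const]

end CharFun

/-! ### Tails of the permuted and of the observed statistic -/

section Tails

lemma integrable_sq_add_sq_of_abs_le {W : Type*} [MeasurableSpace W] {ν : Measure W}
    [IsProbabilityMeasure ν] {f g : W → ℝ}
    (hf : Measurable f) (hg : Measurable g) {C : ℝ} (hfb : ∀ w, |f w| ≤ C) (hgb : ∀ w, |g w| ≤ C) :
    Integrable (fun w => f w ^ 2 + g w ^ 2) ν := by
  refine Integrable.of_bound (by fun_prop) (C ^ 2 + C ^ 2) (ae_of_all _ fun w => ?_)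
  rw [Real.norm_of_nonneg (by positivity)]
  exact add_le_add (sq_le_sq' (abs_le.1 (hfb w)).1 (abs_le.1 (hfb w)).2)
    (sq_le_sq' (abs_le.1 (hgb w)).1 (abs_le.1 (hgb w)).2)

variable {H : Type u} [NormedAddCommGroup H] [InnerProductSpace ℝ H] [MeasurableSpace H]
  [BorelSpace H] {n₁ n₂ : ℕ}

/-- Conditional tail bound for the permuted energy statistic. -/
lemma uniformOn_le_energyStat_le (hn₁ : 0 < n₁) (hn₂ : 0 < n₂) (ν : ProbabilityMeasure H)
    (z : Pooled n₁ n₂ → H) (t : ℝ) :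
    uniformOn (Set.univ : Set (Equiv.Perm (Pooled n₁ n₂)))
        {π | t ≤ energyStat ν fun j => z (π j)} ≤
      ENNReal.ofReal (2 * Real.exp (128 - Real.sqrt (min n₁ n₂ : ℕ) * t)) := by
  simp_rw [energyStat_eq_integral hn₁ hn₂]
  have hm : (0 : ℝ) < (min n₁ n₂ : ℕ) := by exact_mod_cast lt_min hn₁ hn₂
  refine measure_le_integral_sq_add_sq_le
    (X := fun (π : Equiv.Perm (Pooled n₁ n₂)) w => meanDiff fun j => Real.cos ⟪z (π j), w⟫_ℝ)
    (Y := fun (π : Equiv.Perm (Pooled n₁ n₂)) w => meanDiff fun j => Real.sin ⟪z (π j), w⟫_ℝ)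
    (measurable_from_prod_countable_right fun π => ?_)
    (measurable_from_prod_countable_right fun π => ?_)
    (fun π w => (abs_meanDiff_le hn₁ hn₂ fun j => Real.abs_cos_le_one _).trans (by norm_num))
    (fun π w => (abs_meanDiff_le hn₁ hn₂ fun j => Real.abs_sin_le_one _).trans (by norm_num))
    hm (σ := 4 / (min n₁ n₂ : ℕ)) (by push_cast; rfl)
    (fun w => hasSubgaussianMGF_meanDiff_perm hn₁ hn₂ (fun j => Real.cos ⟪z j, w⟫_ℝ)
      fun j => Real.abs_cos_le_one _)
    (fun w => hasSubgaussianMGF_meanDiff_perm hn₁ hn₂ (fun j => Real.sin ⟪z j, w⟫_ℝ)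
      fun j => Real.abs_sin_le_one _) t
  · simp only [Function.uncurry, meanDiff]; fun_prop
  · simp only [Function.uncurry, meanDiff]; fun_prop

variable [SecondCountableTopology H]

/-- Tail bound for the squared `L²(ν)` norm of the centred difference of the empirical
characteristic functionals. -/
lemma pi_le_integral_sq_sub_le (hn₁ : 0 < n₁) (hn₂ : 0 < n₂) (ν : ProbabilityMeasure H)
    (μ : Pooled n₁ n₂ → Measure H) [∀ j, IsProbabilityMeasure (μ j)] (t : ℝ) :
    Measure.pi μ {z | t ≤ ∫ w,
        (meanDiff (fun j => Real.cos ⟪z j, w⟫_ℝ - ∫ x, Real.cos ⟪x, w⟫_ℝ ∂(μ j)) ^ 2 +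
          meanDiff (fun j => Real.sin ⟪z j, w⟫_ℝ - ∫ x, Real.sin ⟪x, w⟫_ℝ ∂(μ j)) ^ 2)
            ∂(ν : Measure H)} ≤
      ENNReal.ofReal (2 * Real.exp (128 - Real.sqrt (min n₁ n₂ : ℕ) * t)) := by
  have hm : (0 : ℝ) < (min n₁ n₂ : ℕ) := by exact_mod_cast lt_min hn₁ hn₂
  have hcosm : ∀ j, Measurable fun w => ∫ x, Real.cos ⟪x, w⟫_ℝ ∂(μ j) := fun j => by
    simp_rw [← charFun_re_eq]
    exact Complex.measurable_re.comp measurable_charFun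
  have hsinm : ∀ j, Measurable fun w => ∫ x, Real.sin ⟪x, w⟫_ℝ ∂(μ j) := fun j => by
    simp_rw [← charFun_im_eq]
    exact Complex.measurable_im.comp measurable_charFun
  have hcosb : ∀ j w, |∫ x, Real.cos ⟪x, w⟫_ℝ ∂(μ j)| ≤ 1 := fun j w => by
    rw [← charFun_re_eq]
    exact (Complex.abs_re_le_norm _).trans (norm_charFun_le_one _)
  have hsinb : ∀ j w, |∫ x, Real.sin ⟪x, w⟫_ℝ ∂(μ j)| ≤ 1 := fun j w => by
    rw [← charFun_im_eq]
    exact (Complex.abs_im_le_norm _).trans (norm_charFun_le_one _)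
  have hbound : ∀ x y : Pooled n₁ n₂ → ℝ, (∀ j, |x j| ≤ 1) → (∀ j, |y j| ≤ 1) →
      |meanDiff fun j => x j - y j| ≤ 4 := fun x y hx hy => by
    rw [meanDiff_sub]
    refine (abs_sub _ _).trans ?_
    linarith [abs_meanDiff_le hn₁ hn₂ hx, abs_meanDiff_le hn₁ hn₂ hy]
  -- The proxy is at most 2/m; it is relaxed to 4/m so that the permuted and the centred fields
  -- share one tail bound.
  have hσ : ((1 / n₁ + 1 / n₂ : NNReal) : ℝ) ≤ 4 / (min n₁ n₂ : ℕ) := by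
    push_cast
    have h1 : (1 : ℝ) / n₁ ≤ 1 / (min n₁ n₂ : ℕ) :=
      one_div_le_one_div_of_le hm (by exact_mod_cast min_le_left _ _)
    have h2 : (1 : ℝ) / n₂ ≤ 1 / (min n₁ n₂ : ℕ) :=
      one_div_le_one_div_of_le hm (by exact_mod_cast min_le_right _ _)
    have h3 : (4 : ℝ) / (min n₁ n₂ : ℕ) = 4 * (1 / (min n₁ n₂ : ℕ)) := by ring
    have h4 : (0 : ℝ) < 1 / (min n₁ n₂ : ℕ) := by positivity
    push_cast at *
    linarith
  refine measure_le_integral_sq_add_sq_le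
    (X := fun (z : Pooled n₁ n₂ → H) w =>
      meanDiff fun j => Real.cos ⟪z j, w⟫_ℝ - ∫ x, Real.cos ⟪x, w⟫_ℝ ∂(μ j))
    (Y := fun (z : Pooled n₁ n₂ → H) w =>
      meanDiff fun j => Real.sin ⟪z j, w⟫_ℝ - ∫ x, Real.sin ⟪x, w⟫_ℝ ∂(μ j))
    ?_ ?_
    (fun z w => hbound _ _ (fun j => Real.abs_cos_le_one _) fun j => hcosb j w)
    (fun z w => hbound _ _ (fun j => Real.abs_sin_le_one _) fun j => hsinb j w)
    hm hσ
    (fun w => hasSubgaussianMGF_meanDiff_sub hn₁ hn₂ μ (g := fun x => Real.cos ⟪x, w⟫_ℝ)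
      (by fun_prop) fun j => Real.abs_cos_le_one _)
    (fun w => hasSubgaussianMGF_meanDiff_sub hn₁ hn₂ μ (g := fun x => Real.sin ⟪x, w⟫_ℝ)
      (by fun_prop) fun j => Real.abs_sin_le_one _) t
  · have h1 : ∀ j, Measurable fun p : (Pooled n₁ n₂ → H) × H =>
        ∫ x, Real.cos ⟪x, p.2⟫_ℝ ∂(μ j) := fun j => (hcosm j).comp measurable_snd
    simp only [Function.uncurry_def, meanDiff]
    fun_prop
  · have h1 : ∀ j, Measurable fun p : (Pooled n₁ n₂ → H) × H =>
        ∫ x, Real.sin ⟪x, p.2⟫_ℝ ∂(μ j) := fun j => (hsinm j).comp measurable_snd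
    simp only [Function.uncurry_def, meanDiff]
    fun_prop

/-- The energy statistic dominates half the squared population distance minus the squared
estimation error. -/
lemma half_integral_sub_le_energyStat (hn₁ : 0 < n₁) (hn₂ : 0 < n₂) (ν : ProbabilityMeasure H)
    (μ₁ μ₂ : Measure H) [IsProbabilityMeasure μ₁] [IsProbabilityMeasure μ₂]
    (μ : Pooled n₁ n₂ → Measure H) (hμ₁ : ∀ i, μ (Sum.inl i) = μ₁)
    (hμ₂ : ∀ i, μ (Sum.inr i) = μ₂) (z : Pooled n₁ n₂ → H) :
    (∫ w, ‖charFun μ₁ w - charFun μ₂ w‖ ^ 2 ∂(ν : Measure H)) / 2 -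
      ∫ w, (meanDiff (fun j => Real.cos ⟪z j, w⟫_ℝ - ∫ x, Real.cos ⟪x, w⟫_ℝ ∂(μ j)) ^ 2 +
          meanDiff (fun j => Real.sin ⟪z j, w⟫_ℝ - ∫ x, Real.sin ⟪x, w⟫_ℝ ∂(μ j)) ^ 2)
            ∂(ν : Measure H) ≤ energyStat ν z := by
  have h1 : (n₁ : ℝ) ≠ 0 := by positivity
  have h2 : (n₂ : ℝ) ≠ 0 := by positivity
  set D : H → ℂ := fun w => charFun μ₁ w - charFun μ₂ w with hD
  have hDm : Measurable D := measurable_charFun.sub measurable_charFun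
  have hDb : ∀ w, ‖D w‖ ≤ 2 := fun w => (norm_sub_le _ _).trans
    (by linarith [norm_charFun_le_one (μ := μ₁) w, norm_charFun_le_one (μ := μ₂) w])
  have hre : ∀ w, meanDiff (fun j => ∫ x, Real.cos ⟪x, w⟫_ℝ ∂(μ j)) = (D w).re := fun w => by
    simp [meanDiff, hμ₁, hμ₂, ← charFun_re_eq, hD, h1, h2]
  have him : ∀ w, meanDiff (fun j => ∫ x, Real.sin ⟪x, w⟫_ℝ ∂(μ j)) = (D w).im := fun w => by
    simp [meanDiff, hμ₁, hμ₂, ← charFun_im_eq, hD, h1, h2]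
  set C : H → ℝ := fun w => meanDiff fun j => Real.cos ⟪z j, w⟫_ℝ with hC
  set S : H → ℝ := fun w => meanDiff fun j => Real.sin ⟪z j, w⟫_ℝ with hS
  have hCm : Measurable C := by simp only [hC, meanDiff]; fun_prop
  have hSm : Measurable S := by simp only [hS, meanDiff]; fun_prop
  have hCb : ∀ w, |C w| ≤ 2 := fun w => abs_meanDiff_le hn₁ hn₂ fun j => Real.abs_cos_le_one _
  have hSb : ∀ w, |S w| ≤ 2 := fun w => abs_meanDiff_le hn₁ hn₂ fun j => Real.abs_sin_le_one _
  have hReb : ∀ w, |(D w).re| ≤ 2 := fun w => (Complex.abs_re_le_norm _).trans (hDb w)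
  have hImb : ∀ w, |(D w).im| ≤ 2 := fun w => (Complex.abs_im_le_norm _).trans (hDb w)
  have hRem : Measurable fun w => (D w).re := Complex.measurable_re.comp hDm
  have hImm : Measurable fun w => (D w).im := Complex.measurable_im.comp hDm
  simp_rw [meanDiff_sub, hre, him, energyStat_eq_integral hn₁ hn₂]
  have hnorm : ∀ w, ‖D w‖ ^ 2 = (D w).re ^ 2 + (D w).im ^ 2 := fun w => by
    rw [Complex.sq_norm, Complex.normSq_apply]; ring
  change (∫ w, ‖D w‖ ^ 2 ∂(ν : Measure H)) / 2 -
    ∫ w, ((C w - (D w).re) ^ 2 + (S w - (D w).im) ^ 2) ∂(ν : Measure H) ≤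
      ∫ w, (C w ^ 2 + S w ^ 2) ∂(ν : Measure H)
  simp_rw [hnorm]
  have i1 : Integrable (fun w => (D w).re ^ 2 + (D w).im ^ 2) (ν : Measure H) :=
    integrable_sq_add_sq_of_abs_le hRem hImm hReb hImb
  have i2 : Integrable (fun w => (C w - (D w).re) ^ 2 + (S w - (D w).im) ^ 2) (ν : Measure H) :=
    integrable_sq_add_sq_of_abs_le (C := 4) (hCm.sub hRem) (hSm.sub hImm)
      (fun w => (abs_sub _ _).trans (by linarith [hCb w, hReb w]))
      (fun w => (abs_sub _ _).trans (by linarith [hSb w, hImb w]))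
  have i3 : Integrable (fun w => C w ^ 2 + S w ^ 2) (ν : Measure H) :=
    integrable_sq_add_sq_of_abs_le hCm hSm hCb hSb
  rw [← integral_div, ← integral_sub (i1.div_const 2) i2]
  refine integral_mono ((i1.div_const 2).sub i2) i3 fun w => ?_
  -- Pointwise, C² - D²/2 + (C - D)² = (2C - D)²/2 ≥ 0, for real and imaginary parts alike.
  nlinarith [sq_nonneg (2 * C w - (D w).re), sq_nonneg (2 * S w - (D w).im)]

lemma measurable_energyStat (ν : ProbabilityMeasure H) :
    Measurable fun z : Pooled n₁ n₂ → H => energyStat ν z := by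
  have h : Measurable (charFun (ν : Measure H)) := measurable_charFun
  unfold energyStat
  fun_prop

end Tails

/-! ### Separation after contamination -/

section Separation

variable {H : Type u} [NormedAddCommGroup H] [InnerProductSpace ℝ H]
  [MeasurableSpace H] [BorelSpace H] [SecondCountableTopology H]

/-- The separation of the characteristic functionals survives the contamination by errors. -/
lemma le_mul_integral_sq_of_mem_alternatives {ν : ProbabilityMeasure H} {cU s K ρ : ℝ}
    (hcU : 0 < cU) (hK : 0 < K)
    (hν : ∫⁻ w, ENNReal.ofReal ((1 + ‖w‖) ^ (2 * s)) ∂(ν : Measure H) ≤ ENNReal.ofReal K)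
    {P : ProbabilityMeasure H × ProbabilityMeasure H} (hP : P ∈ alternatives ν ρ)
    {PU : ProbabilityMeasure H} (hPU : PU ∈ errorLaws H cU s) :
    ρ ≤ K / cU ^ 2 * ∫ w, ‖charFun ((P.1 : Measure H).conv (PU : Measure H)) w -
      charFun ((P.2 : Measure H).conv (PU : Measure H)) w‖ ^ 2 ∂(ν : Measure H) := by
  have hone : ∀ w : H, 0 < 1 + ‖w‖ := fun w => by positivity
  set h : H → ℝ := fun w => ‖charFun (P.1 : Measure H) w - charFun (P.2 : Measure H) w‖ with hh
  set f : H → ℝ := fun w => ‖charFun ((P.1 : Measure H).conv (PU : Measure H)) w -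
      charFun ((P.2 : Measure H).conv (PU : Measure H)) w‖ with hf
  set g : H → ℝ := fun w => cU⁻¹ * (1 + ‖w‖) ^ s with hg
  have hhm : Measurable h := (measurable_charFun.sub measurable_charFun).norm
  have hfm : Measurable f := (measurable_charFun.sub measurable_charFun).norm
  have hgm : Measurable g := by fun_prop
  have hfh : ∀ w, f w = h w * ‖charFun (PU : Measure H) w‖ := fun w => by
    simp only [hf, hh, charFun_conv]
    rw [← sub_mul, norm_mul]
  have hfb : ∀ w, f w ≤ 2 := fun w => (norm_sub_le _ _).trans
    (by linarith [norm_charFun_le_one (μ := (P.1 : Measure H).conv (PU : Measure H)) w,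
      norm_charFun_le_one (μ := (P.2 : Measure H).conv (PU : Measure H)) w])
  have hf0 : ∀ w, 0 ≤ f w := fun w => norm_nonneg _
  have hh0 : ∀ w, 0 ≤ h w := fun w => norm_nonneg _
  have hg0 : ∀ w, 0 ≤ g w := fun w => by have := hone w; positivity
  have hle : ∀ w, h w ≤ f w * g w := fun w => by
    -- `g` is the reciprocal of the assumed lower bound on the characteristic functional of the
    -- errors, so multiplying by `g` undoes the contamination.
    have h1 : 1 ≤ ‖charFun (PU : Measure H) w‖ * g w := by
      have h2 := hPU w
      have h3 : cU * (1 + ‖w‖) ^ (-s) * g w = 1 := by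
        simp only [hg]
        rw [Real.rpow_neg (hone w).le]
        have := Real.rpow_pos_of_pos (hone w) s
        field_simp
      rw [← h3]
      exact mul_le_mul_of_nonneg_right h2 (hg0 w)
    rw [hfh, mul_assoc]
    exact le_mul_of_one_le_right (hh0 w) h1
  have hg2 : ∀ w, g w ^ 2 = (cU ^ 2)⁻¹ * (1 + ‖w‖) ^ (2 * s) := fun w => by
    simp only [hg]
    rw [mul_pow, inv_pow, mul_comm 2 s, Real.rpow_mul (hone w).le]
    norm_num
  have hmm : Measurable fun w : H => (1 + ‖w‖) ^ (2 * s) := by fun_prop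
  have hmom : Integrable (fun w => (1 + ‖w‖) ^ (2 * s)) (ν : Measure H) := by
    refine ⟨hmm.aestronglyMeasurable, ?_⟩
    rw [hasFiniteIntegral_iff_ofReal (ae_of_all _ fun w => by have := hone w; positivity)]
    exact hν.trans_lt ENNReal.ofReal_lt_top
  have hmomK : ∫ w, (1 + ‖w‖) ^ (2 * s) ∂(ν : Measure H) ≤ K := by
    rw [integral_eq_lintegral_of_nonneg_ae
      (ae_of_all _ fun w => by have := hone w; positivity)
      hmm.aestronglyMeasurable]
    exact ENNReal.toReal_le_of_le_ofReal hK.le hν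
  have hgint : Integrable (fun w => g w ^ 2) (ν : Measure H) := by
    simp_rw [hg2]; exact hmom.const_mul _
  have hgK : ∫ w, g w ^ 2 ∂(ν : Measure H) ≤ K / cU ^ 2 := by
    simp_rw [hg2, integral_const_mul]
    rw [inv_mul_eq_div]
    gcongr
  have hfint : Integrable (fun w => f w ^ 2) (ν : Measure H) := by
    refine Integrable.of_bound (by fun_prop) 4 (ae_of_all _ fun w => ?_)
    rw [Real.norm_of_nonneg (by positivity)]
    nlinarith [hf0 w, hfb w]
  have hfL : MemLp f (ENNReal.ofReal 2) (ν : Measure H) := by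
    rw [ENNReal.ofReal_ofNat, memLp_two_iff_integrable_sq hfm.aestronglyMeasurable]; exact hfint
  have hgL : MemLp g (ENNReal.ofReal 2) (ν : Measure H) := by
    rw [ENNReal.ofReal_ofNat, memLp_two_iff_integrable_sq hgm.aestronglyMeasurable]; exact hgint
  have hcs := integral_mul_le_Lp_mul_Lq_of_nonneg (μ := (ν : Measure H)) Real.HolderConjugate.two_two
    (ae_of_all _ hf0) (ae_of_all _ hg0) hfL hgL
  have hfgint : Integrable (fun w => f w * g w) (ν : Measure H) := by
    have : Integrable (fun w => f w ^ 2 + g w ^ 2) (ν : Measure H) := hfint.add hgint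
    refine this.mono' (by fun_prop) (ae_of_all _ fun w => ?_)
    rw [Real.norm_of_nonneg (mul_nonneg (hf0 w) (hg0 w))]
    nlinarith [sq_nonneg (f w - g w), hf0 w, hg0 w]
  have hhint : Integrable h (ν : Measure H) :=
    hfgint.mono' hhm.aestronglyMeasurable (ae_of_all _ fun w => by
      rw [Real.norm_of_nonneg (hh0 w)]; exact hle w)
  have hI : ∫ w, h w ∂(ν : Measure H) ≤ ∫ w, f w * g w ∂(ν : Measure H) :=
    integral_mono hhint hfgint hle
  have hI0 : 0 ≤ ∫ w, h w ∂(ν : Measure H) := integral_nonneg hh0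
  have hf20 : 0 ≤ ∫ w, f w ^ 2 ∂(ν : Measure H) := integral_nonneg fun w => sq_nonneg _
  have hg20 : 0 ≤ ∫ w, g w ^ 2 ∂(ν : Measure H) := integral_nonneg fun w => sq_nonneg _
  simp only [Real.rpow_ofNat, ← Real.sqrt_eq_rpow] at hcs
  calc ρ ≤ (∫ w, h w ∂(ν : Measure H)) ^ 2 := hP
    _ ≤ (√(∫ w, f w ^ 2 ∂(ν : Measure H)) * √(∫ w, g w ^ 2 ∂(ν : Measure H))) ^ 2 := by
        gcongr; exact hI.trans hcs
    _ = (∫ w, g w ^ 2 ∂(ν : Measure H)) * ∫ w, f w ^ 2 ∂(ν : Measure H) := by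
        rw [mul_pow, Real.sq_sqrt hf20, Real.sq_sqrt hg20, mul_comm]
    _ ≤ _ := by gcongr

end Separation

/-! ### Type II error of the permutation test -/

/-- Events on the contaminated sample have the probability they have for independent draws from
the convolutions with the error law. -/
lemma experimentLaw_add_le {H : Type u} [NormedAddCommGroup H] [MeasurableSpace H]
    [BorelSpace H] [SecondCountableTopology H] {n₁ n₂ B : ℕ} (P₁ P₂ PU : ProbabilityMeasure H) (S : Set (Pooled n₁ n₂ → H)) :
    experimentLaw n₁ n₂ B P₁ P₂ PU {ω | ω.1 + ω.2.1 ∈ S} ≤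
      Measure.pi (fun j : Pooled n₁ n₂ =>
        (Sum.elim (fun _ => (P₁ : Measure H)) (fun _ => (P₂ : Measure H)) j).conv
          (PU : Measure H)) S := by
  have : ∀ j : Pooled n₁ n₂, IsProbabilityMeasure
      (Sum.elim (fun _ => (P₁ : Measure H)) (fun _ => (P₂ : Measure H)) j) := by
    rintro (i | i) <;> simp only [Sum.elim_inl, Sum.elim_inr] <;> infer_instance
  have h1 : MeasurePreserving (Prod.map id Prod.fst) (experimentLaw n₁ n₂ B P₁ P₂ PU)
      ((Measure.pi (fun j : Pooled n₁ n₂ =>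
        Sum.elim (fun _ => (P₁ : Measure H)) (fun _ => (P₂ : Measure H)) j)).prod
        (Measure.pi (fun _ : Pooled n₁ n₂ => (PU : Measure H)))) :=
    (MeasurePreserving.id _).prod measurePreserving_fst
  rw [← map_add_pi_prod_pi, ← h1.map_eq, Measure.map_map (by fun_prop) h1.measurable]
  -- This inequality holds for every set, so `S` need not be measurable.
  exact Measure.le_map_apply (Measurable.aemeasurable
    (measurable_fst.add measurable_snd.fst)) S

section TypeII

variable {H : Type u} [NormedAddCommGroup H] [InnerProductSpace ℝ H] [MeasurableSpace H]
  {n₁ n₂ B : ℕ}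

/-- If the test does not reject and the observed statistic is at least `t`, then a fraction `α` of
the permuted statistics is at least `t`. -/
lemma le_frequency_of_permTest_eq_zero {α t : ℝ} {ν : ProbabilityMeasure H}
    {z : Pooled n₁ n₂ → H} {π : Fin B → Equiv.Perm (Pooled n₁ n₂)} (hB : 0 < B)
    (h : permTest α ν z π = 0) (ht : t ≤ energyStat ν z) :
    α ≤ 1 / (B : ℝ) * ∑ b, {σ : Equiv.Perm (Pooled n₁ n₂) |
      t ≤ energyStat ν fun j => z (σ j)}.indicator (fun _ => (1 : ℝ)) (π b) := by
  classical
  have hBr : (0 : ℝ) < B := by exact_mod_cast hB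
  have h1 : ¬ (1 - α < 1 / (B : ℝ) *
      ∑ b, (if energyStat ν (fun j => z (π b j)) < energyStat ν z then (1 : ℝ) else 0)) := by
    intro hlt
    have : permTest α ν z π = 1 := by
      unfold permTest
      rw [if_pos]
      convert hlt
    omega
  rw [not_lt] at h1
  -- A permuted statistic below `t` is strictly below the observed one, hence counts towards
  -- rejection.
  have h2 : ∑ b, (1 - {σ : Equiv.Perm (Pooled n₁ n₂) |
      t ≤ energyStat ν fun j => z (σ j)}.indicator (fun _ => (1 : ℝ)) (π b)) ≤
      ∑ b, (if energyStat ν (fun j => z (π b j)) < energyStat ν z then (1 : ℝ) else 0) := by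
    refine Finset.sum_le_sum fun b _ => ?_
    by_cases hb : t ≤ energyStat ν fun j => z (π b j)
    · rw [Set.indicator_of_mem (by exact hb), sub_self]
      split_ifs <;> norm_num
    · rw [Set.indicator_of_notMem (by exact hb), if_pos ((not_le.1 hb).trans_le ht), sub_zero]
  rw [Finset.sum_sub_distrib] at h2
  simp only [Finset.sum_const, Finset.card_univ, Fintype.card_fin, nsmul_eq_mul, mul_one] at h2
  have h3 : 1 / (B : ℝ) * (B - ∑ b, {σ : Equiv.Perm (Pooled n₁ n₂) |
      t ≤ energyStat ν fun j => z (σ j)}.indicator (fun _ => (1 : ℝ)) (π b)) ≤ 1 - α :=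
    (mul_le_mul_of_nonneg_left h2 (by positivity)).trans h1
  rw [mul_sub, one_div_mul_cancel hBr.ne'] at h3
  linarith

variable [BorelSpace H] [SecondCountableTopology H]

/-- The probability that a fraction of at least `α` of the permuted statistics is large. -/
lemma experimentLaw_frequency_le (P₁ P₂ PU ν : ProbabilityMeasure H) {α t : ℝ} (hα : 0 < α)
    (hB : 0 < B)
    (ht : ∀ z : Pooled n₁ n₂ → H, uniformOn (Set.univ : Set (Equiv.Perm (Pooled n₁ n₂)))
        {π | t ≤ energyStat ν fun j => z (π j)} ≤ ENNReal.ofReal (α / 2)) :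
    experimentLaw n₁ n₂ B P₁ P₂ PU {ω | α ≤ 1 / (B : ℝ) *
      ∑ b, {σ : Equiv.Perm (Pooled n₁ n₂) |
        t ≤ energyStat ν fun j => (ω.1 + ω.2.1) (σ j)}.indicator (fun _ => (1 : ℝ)) (ω.2.2 b)} ≤
      ENNReal.ofReal (Real.exp (-(B * α ^ 2 / 2))) := by
  have : ∀ j : Pooled n₁ n₂, IsProbabilityMeasure
      (Sum.elim (fun _ => (P₁ : Measure H)) (fun _ => (P₂ : Measure H)) j) := by
    rintro (i | i) <;> simp only [Sum.elim_inl, Sum.elim_inr] <;> infer_instance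
  set E : Set ((Pooled n₁ n₂ → H) × (Pooled n₁ n₂ → H) ×
      (Fin B → Equiv.Perm (Pooled n₁ n₂))) := {ω | α ≤ 1 / (B : ℝ) *
      ∑ b, {σ : Equiv.Perm (Pooled n₁ n₂) |
        t ≤ energyStat ν fun j => (ω.1 + ω.2.1) (σ j)}.indicator (fun _ => (1 : ℝ)) (ω.2.2 b)}
    with hE
  have hS : MeasurableSet {q : (Pooled n₁ n₂ → H) × Equiv.Perm (Pooled n₁ n₂) |
      t ≤ energyStat ν fun j => q.1 (q.2 j)} := by
    refine measurableSet_le measurable_const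
      (measurable_from_prod_countable_left (f := fun q : (Pooled n₁ n₂ → H) ×
        Equiv.Perm (Pooled n₁ n₂) => energyStat ν fun j => q.1 (q.2 j)) fun σ => ?_)
    exact (measurable_energyStat ν).comp
      (measurable_pi_lambda _ fun j => measurable_pi_apply (σ j))
  have hEm : MeasurableSet E := by
    have hterm : ∀ b : Fin B, Measurable fun ω : (Pooled n₁ n₂ → H) × (Pooled n₁ n₂ → H) ×
        (Fin B → Equiv.Perm (Pooled n₁ n₂)) => {σ : Equiv.Perm (Pooled n₁ n₂) |
          t ≤ energyStat ν fun j => (ω.1 + ω.2.1) (σ j)}.indicator (fun _ => (1 : ℝ))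
            (ω.2.2 b) := fun b => by
      have hφ : Measurable fun ω : (Pooled n₁ n₂ → H) × (Pooled n₁ n₂ → H) ×
          (Fin B → Equiv.Perm (Pooled n₁ n₂)) => (ω.1 + ω.2.1, ω.2.2 b) :=
        (measurable_fst.add measurable_snd.fst).prodMk
          ((measurable_pi_apply b).comp measurable_snd.snd)
      classical
      simp only [Set.indicator_apply]
      exact Measurable.ite (hφ hS) measurable_const measurable_const
    exact measurableSet_le measurable_const
      ((Finset.measurable_fun_sum _ fun b _ => hterm b).const_mul _)
  -- Conditionally on observations and errors, the permutations are still iid uniform, so Hoeffding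
  -- applies on each section with a bound free of the data.
  have hsec : ∀ x u, Measure.pi (fun _ : Fin B =>
      uniformOn (Set.univ : Set (Equiv.Perm (Pooled n₁ n₂))))
      (Prod.mk u ⁻¹' (Prod.mk x ⁻¹' E)) ≤ ENNReal.ofReal (Real.exp (-(B * α ^ 2 / 2))) :=
    fun x u => pi_frequency_ge_le (MeasurableSet.of_discrete) hα (ht (x + u)) hB
  rw [experimentLaw, Measure.prod_apply hEm]
  refine (lintegral_mono (g := fun _ => ENNReal.ofReal (Real.exp (-(B * α ^ 2 / 2))))
    fun x => ?_).trans (by simp)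
  rw [Measure.prod_apply (measurable_prodMk_left hEm)]
  exact (lintegral_mono (g := fun _ => ENNReal.ofReal (Real.exp (-(B * α ^ 2 / 2))))
    fun u => hsec x u).trans (by simp)

/-- The type II error is small as soon as the characteristic functionals of the contaminated laws
are well separated in `L²(ν)`. -/
lemma typeIIError_le (hn₁ : 0 < n₁) (hn₂ : 0 < n₂) (hB : 0 < B)
    (ν P₁ P₂ PU : ProbabilityMeasure H) {α β t : ℝ} (hα : 0 < α) (hβ : 0 < β)
    (htα : 2 * Real.exp (128 - Real.sqrt (min n₁ n₂ : ℕ) * t) ≤ α / 2)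
    (htβ : 2 * Real.exp (128 - Real.sqrt (min n₁ n₂ : ℕ) * t) ≤ β / 2)
    (hBβ : Real.exp (-(B * α ^ 2 / 2)) ≤ β / 2)
    (hsep : 4 * t ≤ ∫ w, ‖charFun ((P₁ : Measure H).conv (PU : Measure H)) w -
      charFun ((P₂ : Measure H).conv (PU : Measure H)) w‖ ^ 2 ∂(ν : Measure H)) :
    typeIIError n₁ n₂ B α ν P₁ P₂ PU ≤ ENNReal.ofReal β := by
  set μ : Pooled n₁ n₂ → Measure H := fun j =>
    (Sum.elim (fun _ => (P₁ : Measure H)) (fun _ => (P₂ : Measure H)) j).conv (PU : Measure H)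
    with hμ
  have : ∀ j, IsProbabilityMeasure (μ j) := by
    rintro (i | i) <;> simp only [hμ, Sum.elim_inl, Sum.elim_inr] <;> infer_instance
  set S : Set (Pooled n₁ n₂ → H) := {z | t ≤ ∫ w,
        (meanDiff (fun j => Real.cos ⟪z j, w⟫_ℝ - ∫ x, Real.cos ⟪x, w⟫_ℝ ∂(μ j)) ^ 2 +
          meanDiff (fun j => Real.sin ⟪z j, w⟫_ℝ - ∫ x, Real.sin ⟪x, w⟫_ℝ ∂(μ j)) ^ 2)
            ∂(ν : Measure H)} with hS
  have hsub : {ω : (Pooled n₁ n₂ → H) × (Pooled n₁ n₂ → H) ×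
      (Fin B → Equiv.Perm (Pooled n₁ n₂)) | permTest α ν (ω.1 + ω.2.1) ω.2.2 = 0} ⊆
      {ω | ω.1 + ω.2.1 ∈ S} ∪ {ω | α ≤ 1 / (B : ℝ) *
      ∑ b, {σ : Equiv.Perm (Pooled n₁ n₂) |
        t ≤ energyStat ν fun j => (ω.1 + ω.2.1) (σ j)}.indicator (fun _ => (1 : ℝ)) (ω.2.2 b)} := by
    intro ω hω
    by_cases hωS : ω.1 + ω.2.1 ∈ S
    · exact Or.inl hωS
    · refine Or.inr (le_frequency_of_permTest_eq_zero hB hω ?_)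
      have h1 := half_integral_sub_le_energyStat hn₁ hn₂ ν
        ((P₁ : Measure H).conv (PU : Measure H)) ((P₂ : Measure H).conv (PU : Measure H)) μ
        (fun _ => rfl) (fun _ => rfl) (ω.1 + ω.2.1)
      rw [hS, Set.mem_ofPred_eq, not_le] at hωS
      -- Half the separation is at least 2t and the error is below t, which leaves t for the
      -- observed statistic.
      linarith
  calc typeIIError n₁ n₂ B α ν P₁ P₂ PU
      ≤ ENNReal.ofReal (β / 2) + ENNReal.ofReal (β / 2) := by
        refine (measure_mono hsub).trans ((measure_union_le _ _).trans (add_le_add ?_ ?_))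
        · exact (experimentLaw_add_le P₁ P₂ PU S).trans
            ((pi_le_integral_sq_sub_le hn₁ hn₂ ν μ t).trans (ENNReal.ofReal_le_ofReal htβ))
        · exact (experimentLaw_frequency_le P₁ P₂ PU ν hα hB fun z =>
            (uniformOn_le_energyStat_le hn₁ hn₂ ν z t).trans
              (ENNReal.ofReal_le_ofReal htα)).trans (ENNReal.ofReal_le_ofReal hBβ)
    _ = ENNReal.ofReal β := by
        rw [← ENNReal.ofReal_add (by positivity) (by positivity), add_halves]

end TypeII

/-! ### Choice of constants and the rate -/

lemma two_mul_exp_sub_le {α β : ℝ} (hα : 0 < α) (hα1 : α ≤ 1) (hβ : 0 < β)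
    (hβe : β < 1 / Real.exp 1) :
    2 * Real.exp (128 - 132 * (Real.log α⁻¹ + Real.log β⁻¹)) ≤ α / 2 ∧
      2 * Real.exp (128 - 132 * (Real.log α⁻¹ + Real.log β⁻¹)) ≤ β / 2 := by
  have hlα : 0 ≤ Real.log α⁻¹ := Real.log_nonneg ((one_le_inv₀ hα).2 hα1)
  have hlβ : 1 ≤ Real.log β⁻¹ := by
    rw [Real.le_log_iff_exp_le (by positivity), ← one_div]
    exact (le_one_div (Real.exp_pos 1) hβ).2 hβe.le
  have h4 : Real.exp (-3) ≤ 1 / 4 := by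
    rw [Real.exp_neg, ← one_div]
    exact one_div_le_one_div_of_le (by norm_num) (by linarith [Real.add_one_le_exp (3 : ℝ)])
  -- With L = log α⁻¹ + log β⁻¹, both L ≥ 1 (from β < 1/e) and L ≥ log γ⁻¹ hold for γ = α, β. Hence
  -- 132L ≥ 131 + log γ⁻¹, which absorbs 128 and leaves exp(-3) ≤ 1/4.
  have key : ∀ γ : ℝ, 0 < γ → 128 - 132 * (Real.log α⁻¹ + Real.log β⁻¹) ≤ -3 + Real.log γ →
      2 * Real.exp (128 - 132 * (Real.log α⁻¹ + Real.log β⁻¹)) ≤ γ / 2 := fun γ hγ h => by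
    have h5 := Real.exp_le_exp.2 h
    rw [Real.exp_add, Real.exp_log hγ] at h5
    nlinarith
  refine ⟨key α hα ?_, key β hβ ?_⟩
  · simp only [Real.log_inv] at *; linarith
  · simp only [Real.log_inv] at *; linarith

end

end EnergyTest

theorem mainTheorem12 (c₁ c₂ c s cU : ℝ) (hc₁ : 0 < c₁) (hc₂ : 0 < c₂) (hc : 0 < c) (hs : 0 < s)
    (hcU : 0 < cU) :
    ∃ c₀ : ℝ, 0 < c₀ ∧
      ∀ (H : Type u) [NormedAddCommGroup H] [InnerProductSpace ℝ H] [CompleteSpace H]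
        [TopologicalSpace.SeparableSpace H] [MeasurableSpace H] [BorelSpace H]
        (n₁ n₂ B : ℕ) (α β : ℝ),
        0 < n₁ → 0 < n₂ → c₁ ≤ (n₁ : ℝ) / n₂ → (n₁ : ℝ) / n₂ ≤ c₂ →
        0 < α → 0 < β → α + β < 1 → β < 1 / Real.exp 1 →
        2 * α ^ (-2 : ℤ) * Real.log (6 / β) ≤ B →
        EnergyTest.separationRate H c cU s n₁ n₂ B α β ≤
          ENNReal.ofReal (c₀ * ((n₁ : ℝ) + n₂) ^ (-(1 / 2) : ℝ) *
            (Real.log α⁻¹ + Real.log β⁻¹)) := by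
  obtain ⟨K, hK, hmom⟩ := EnergyTest.exists_lintegral_one_add_norm_rpow_le.{u} c s
  -- The ratio bounds give n₁ + n₂ ≤ (1 + 1/c₁)n₁ and n₁ + n₂ ≤ (1 + c₂)n₂; the sum of the factors
  -- serves whichever sample is smaller.
  set R : ℝ := (1 + 1 / c₁) + (1 + c₂) with hR
  have hR0 : 0 < R := by positivity
  refine ⟨K / cU ^ 2 * (4 * (132 * √R)), by positivity, ?_⟩
  intro H _ _ _ _ _ _ n₁ n₂ B α β hn₁ hn₂ hr₁ hr₂ hα hβ hαβ hβe hB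
  have : SecondCountableTopology H := UniformSpace.secondCountable_of_separable H
  have hn₁' : (0 : ℝ) < n₁ := by exact_mod_cast hn₁
  have hn₂' : (0 : ℝ) < n₂ := by exact_mod_cast hn₂
  have hm0 : (0 : ℝ) < (min n₁ n₂ : ℕ) := by exact_mod_cast lt_min hn₁ hn₂
  have hα1 : α ≤ 1 := by linarith
  have hβ1 : β < 1 := by linarith
  set L : ℝ := Real.log α⁻¹ + Real.log β⁻¹ with hL
  have hL0 : 0 < L :=
    add_pos_of_nonneg_of_pos (Real.log_nonneg ((one_le_inv₀ hα).2 hα1))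
      (Real.log_pos ((one_lt_inv₀ hβ).2 hβ1))
  have hmin : (n₁ : ℝ) + n₂ ≤ R * (min n₁ n₂ : ℕ) := by
    rw [le_div_iff₀ hn₂'] at hr₁
    rw [div_le_iff₀ hn₂'] at hr₂
    have h1 : (n₂ : ℝ) ≤ 1 / c₁ * n₁ := by
      rw [one_div, inv_mul_eq_div, le_div_iff₀ hc₁]; linarith
    have hc1 : 0 < 1 / c₁ := by positivity
    rcases le_total n₁ n₂ with h | h
    · rw [min_eq_left h, hR]; nlinarith
    · rw [min_eq_right h, hR]; nlinarith
  have hlog6 : 0 < Real.log (6 / β) := Real.log_pos (by rw [lt_div_iff₀ hβ]; linarith)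
  have hB' : 2 * Real.log (6 / β) ≤ B * α ^ 2 := by
    have h1 : α ^ (-2 : ℤ) * α ^ 2 = 1 := by
      rw [zpow_neg, ← zpow_natCast α 2]
      exact inv_mul_cancel₀ (by positivity)
    calc 2 * Real.log (6 / β) = 2 * α ^ (-2 : ℤ) * Real.log (6 / β) * α ^ 2 := by
          linear_combination (-2 * Real.log (6 / β)) * h1
      _ ≤ _ := by gcongr
  have hB0 : 0 < B := by
    rcases Nat.eq_zero_or_pos B with h | h
    · rw [h] at hB'; push_cast at hB'; linarith
    · exact h
  have hBβ : Real.exp (-(B * α ^ 2 / 2)) ≤ β / 2 := by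
    calc Real.exp (-(B * α ^ 2 / 2)) ≤ Real.exp (-Real.log (6 / β)) :=
          Real.exp_le_exp.2 (by linarith)
      _ = β / 6 := by rw [Real.exp_neg, Real.exp_log (by positivity), inv_div]
      _ ≤ β / 2 := by linarith
  -- Chosen so that √m t = 132L, the exponent treated in `two_mul_exp_sub_le`.
  set t : ℝ := 132 * L / √(min n₁ n₂ : ℕ) with ht
  have hsm : 0 < √((min n₁ n₂ : ℕ) : ℝ) := Real.sqrt_pos.2 hm0
  have hmt : √((min n₁ n₂ : ℕ) : ℝ) * t = 132 * L := by rw [ht]; field_simp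
  obtain ⟨hexpα, hexpβ⟩ := EnergyTest.two_mul_exp_sub_le hα hα1 hβ hβe
  rw [← hL, ← hmt] at hexpα hexpβ
  have hsum0 : (0 : ℝ) < (n₁ : ℝ) + n₂ := by positivity
  have hrate : ((n₁ : ℝ) + n₂) ^ (-(1 / 2) : ℝ) = 1 / √((n₁ : ℝ) + n₂) := by
    rw [Real.rpow_neg hsum0.le, ← Real.sqrt_eq_rpow, one_div]
  have htle : t ≤ 132 * √R * ((n₁ : ℝ) + n₂) ^ (-(1 / 2) : ℝ) * L := by
    have h1 : √((n₁ : ℝ) + n₂) ≤ √R * √((min n₁ n₂ : ℕ) : ℝ) := by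
      rw [← Real.sqrt_mul hR0.le]; exact Real.sqrt_le_sqrt hmin
    have h2 : 0 < √((n₁ : ℝ) + n₂) := Real.sqrt_pos.2 hsum0
    rw [hrate, ht, div_le_iff₀ hsm]
    have h3 : 132 * √R * (1 / √((n₁ : ℝ) + n₂)) * L * √((min n₁ n₂ : ℕ) : ℝ) =
        132 * L * (√R * √((min n₁ n₂ : ℕ) : ℝ) / √((n₁ : ℝ) + n₂)) := by ring
    rw [h3]
    exact le_mul_of_one_le_right (by positivity) ((one_le_div h2).2 h1)
  -- The claimed bound is itself an admissible ρ: it is at least 4t · K/cU².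
  refine iInf₂_le _ ⟨by positivity, ?_⟩
  refine iSup₂_le fun ν hν => iSup₂_le fun P hP => iSup₂_le fun PU hPU => ?_
  refine EnergyTest.typeIIError_le hn₁ hn₂ hB0 ν P.1 P.2 PU hα hβ hexpα hexpβ hBβ ?_
  have hsep := EnergyTest.le_mul_integral_sq_of_mem_alternatives hcU hK (hmom H ν hν) hP hPU
  have hKc : 0 < K / cU ^ 2 := by positivity
  refine le_of_mul_le_mul_left (le_trans ?_ hsep) hKc
  calc K / cU ^ 2 * (4 * t)
      ≤ K / cU ^ 2 * (4 * (132 * √R * ((n₁ : ℝ) + n₂) ^ (-(1 / 2) : ℝ) * L)) := by gcongr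
    _ = _ := by ring
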